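/- Let $d\ge 1$. For each $n\ge1$ let $\psi=\psi_n:\mathbb Z^d\to\{0,1\}$ be the test signal equal to $1$ at $k$ if $a_\ell\le k_\ell\le b_\ell$ for $1\le \ell\le d$, and $0$ otherwise, with integers $a_\ell,b_\ell$ that may depend on $n$; put $c_\ell=(b_\ell-a_\ell+1)/n$ and assume that each $c_\ell$ is fixed or converges to a finite positive limit as $n\to\infty$. Let $f$ be a fixed, continuous, spherically symmetric, compactly supported probability density on $\mathbb R^d$ with $\sup_{t\in\mathbb R^d}(1+\|t\|)^p|f^{\mathrm{Ft}}(t)|<\infty$, where $f^{\mathrm{Ft}}(t)=\int f(x)e^{it^{\top}x}\,dx$. Let $\lambda_n,\sigma_n>0$ and $\delta_n=\lambda_n^{-1}$. For $\xi\in\mathbb R^d$ and $\theta\in\{0,1\}$ let $$\chi_\theta(x)=c_{1,\theta}\,\delta_n^d f(\delta_n x)\{1+\theta\cos(\xi^{\top}x)\},\qquad c_{1,\theta}^{-1}=1+\theta f^{\mathrm{Ft}}(\xi/\delta_n),$$ $$\phi_\theta(j)=c_{2,\theta}\,n^{-d}\chi_\theta(j/n),\quad j\in\mathbb Z^d,$$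 where $c_{2,\theta}$ is chosen so that $\sum_j\phi_\theta(j)=1$. When the true blur function is $\phi_\theta$, the data are $Y(j)=\sum_k\phi_\theta(j-k)\psi(k)+N(j)$, $j\in\mathbb Z^d$, and for an estimator $\hat\phi$, that is, a measurable function of the data, $\mathrm{MSSE}_{n\theta}=E\sum_{j\in\mathbb Z^d}|\hat\phi(j)-\phi_\theta(j)|^2$. Theorem 3.2. Assume that $\delta_n\asymp(\sigma_n^2/n^d)^{1/(3d)}$ (the ratio of the two sides is bounded away from zero and infinity as $n\to\infty$), that $C_1n^{-C_2}\le\delta_n^{2d}\le C_3n^{-C_4}$ for all $n\ge1$, where $C_1,\dots,C_4>0$ and $d(1-p^{-1})\le C_4\le C_2$, and that $p>\frac32 d$ and $p\ge\frac34C_2+1$. Suppose, too, that for each $n$ the noise variables $N(j)$ are independent and identically distributed as Normal $N(0,\sigma_n^2)$. Then, for a choice of $\xi$ that depends only on $c_1,\dots,c_d$, the constants $c_{2,\theta}$ exist for all sufficiently large $n$, and for every sequence of estimators $$\liminf_{n\to\infty}\Big(\frac{n^d}{\lambda_n^d\sigma_n^2}\Big)^{1/2}\sup_{\theta=0,1}n^d\,\mathrm{MSSE}_{n\theta}>0.$$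 -/

import Mathlib

open MeasureTheory ProbabilityTheory Filter
open scoped ENNReal Topology RealInnerProductSpace Asymptotics

noncomputable section

namespace BlurEstimation

/-- The fixed profile: a spherically symmetric, compactly supported probability density on
`ℝ^d`. It is evaluated at lattice points, so it is the continuous version of the density. -/
structure IsProfile {d : ℕ} (f : EuclideanSpace ℝ (Fin d) → ℝ) : Prop where
  continuous : Continuous f
  nonneg : ∀ x, 0 ≤ f x
  integral_eq_one : ∫ x, f x = 1
  hasCompactSupport : HasCompactSupport f
  symmetric : ∀ x y, ‖x‖ = ‖y‖ → f x = f y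

/-- The continuous Fourier transform `f^Ft(t) = ∫ f(x) exp(i tᵀx) dx`. -/
def ft {d : ℕ} (f : EuclideanSpace ℝ (Fin d) → ℝ) (t : EuclideanSpace ℝ (Fin d)) : ℂ :=
  ∫ x, (f x : ℂ) * Complex.exp (Complex.I * (⟪t, x⟫ : ℝ))

/-- The polynomial decay condition `sup_t (1 + ‖t‖)^p |f^Ft(t)| < ∞`. -/
def FtDecay {d : ℕ} (f : EuclideanSpace ℝ (Fin d) → ℝ) (p : ℝ) : Prop :=
  BddAbove (Set.range fun t : EuclideanSpace ℝ (Fin d) => (1 + ‖t‖) ^ p * ‖ft f t‖)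

/-- `c_{1,θ} = {1 + θ f^Ft(ξ/δ)}⁻¹`. For a spherically symmetric `f`, the number `f^Ft(ξ/δ)` is
real, so that it equals its real part. -/
def c₁ {d : ℕ} (f : EuclideanSpace ℝ (Fin d) → ℝ) (δ : ℝ) (ξ : EuclideanSpace ℝ (Fin d))
    (θ : ℝ) : ℝ :=
  (1 + θ * (ft f (δ⁻¹ • ξ)).re)⁻¹

/-- The continuum blur `χ_θ(x) = c_{1,θ} δ^d f(δx) {1 + θ cos(ξᵀx)}`. -/
def chi {d : ℕ} (f : EuclideanSpace ℝ (Fin d) → ℝ) (δ : ℝ) (ξ : EuclideanSpace ℝ (Fin d))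
    (θ : ℝ) (x : EuclideanSpace ℝ (Fin d)) : ℝ :=
  c₁ f δ ξ θ * δ ^ d * f (δ • x) * (1 + θ * Real.cos ⟪ξ, x⟫)

/-- The point `j/n` of `ℝ^d`. -/
def gridPoint {d : ℕ} (n : ℕ) (j : Fin d → ℤ) : EuclideanSpace ℝ (Fin d) :=
  WithLp.toLp 2 fun l => (j l : ℝ) / (n : ℝ)

/-- `c_{2,θ}`, which makes the discretized blur sum to one. -/
def c₂ {d : ℕ} (f : EuclideanSpace ℝ (Fin d) → ℝ) (δ : ℝ) (ξ : EuclideanSpace ℝ (Fin d))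
    (n : ℕ) (θ : ℝ) : ℝ :=
  (∑' j : Fin d → ℤ, ((n : ℝ) ^ d)⁻¹ * chi f δ ξ θ (gridPoint n j))⁻¹

/-- The discretized blur `φ_θ(j) = c_{2,θ} n^{-d} χ_θ(j/n)`, `j ∈ ℤ^d`. -/
def blur {d : ℕ} (f : EuclideanSpace ℝ (Fin d) → ℝ) (δ : ℝ) (ξ : EuclideanSpace ℝ (Fin d))
    (n : ℕ) (θ : ℝ) (j : Fin d → ℤ) : ℝ :=
  c₂ f δ ξ n θ * ((n : ℝ) ^ d)⁻¹ * chi f δ ξ θ (gridPoint n j)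

/-- The test signal: `1` on the lattice prism `{k | a ≤ k ≤ b coordinatewise}`, else `0`. -/
def testSignal {d : ℕ} (a b : Fin d → ℤ) : (Fin d → ℤ) → ℝ :=
  (Set.Icc a b).indicator 1

/-- The scaled edge lengths `c_ℓ = m_ℓ / n`, where `m_ℓ = b_ℓ - a_ℓ + 1`. -/
def edge {d : ℕ} (a b : Fin d → ℤ) (n : ℕ) (l : Fin d) : ℝ :=
  ((b l - a l + 1 : ℤ) : ℝ) / (n : ℝ)

/-- The blurred signal `(φψ)(j) = ∑_k φ(j - k) ψ(k)`. -/
def blurred {d : ℕ} (φ ψ : (Fin d → ℤ) → ℝ) (j : Fin d → ℤ) : ℝ :=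
  ∑' k, φ (j - k) * ψ k

/-- The mean summed squared error `E ∑_j |φ̂(j) - φ(j)|²`, with values in `[0, ∞]`, of the
estimator `est`, a function of the data `Y(j) = (φψ)(j) + N(j)`, `j ∈ ℤ^d`. Complex values of the
estimator are allowed, as Fourier inversion may produce them. -/
def MSSE {d : ℕ} {Ω : Type*} [MeasurableSpace Ω] (P : Measure Ω)
    (N : (Fin d → ℤ) → Ω → ℝ) (ψ φ : (Fin d → ℤ) → ℝ)
    (est : ((Fin d → ℤ) → ℝ) → (Fin d → ℤ) → ℂ) : ℝ≥0∞ :=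
  ∫⁻ ω, ∑' j, ‖est (fun k => blurred φ ψ k + N k ω) j - (φ j : ℂ)‖ₑ ^ 2 ∂P

end BlurEstimation

end

/-!
The lower bound is a two-point argument. With `h = δ/n`, box sides `m_l = b_l - a_l + 1` and
frequency `ξ_l = 2π / c_l = 2πn / m_l`, the two blurs are the normalized lattice samples of `f(h·)`
and of `f(h·) (1 + cos)`, the cosine having period `m_l` in the `l`-th coordinate; the constant
`c_{1,θ}` cancels. Three facts carry the proof.

* The blurs are far apart: their squared `ℓ²` distance is at least of order `h^d`. Indeed, a shift
  by a quarter-period trades small cosines for large ones (`sum_sq_modSample_ge`).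
* Their images of the test box are close: the squared `ℓ²` distance is at most of order
  `(∏ m_l)⁴ h^{3d} ≍ n^d δ^{3d} ≍ σ²`. The convolution of the box with a modulated constant
  vanishes, as the cosine runs through full periods, so only the increments of `f` count, and one
  derivative is gained in each coordinate. On the Fourier side the box kernel at frequency `w` is
  at most of order `∏ m_l² h |w_l|`, and `∏ w_l · 𝓕 f(w)` is square integrable because `p > 3d/2`.
  The passage from the lattice to `ℝ^d` uses duality: the images are paired with a trigonometric
  polynomial, whose square is integrated exactly against a weight that is constant on unit cells
  (`integral_normSq_trigPoly_mul`). This is `sum_norm_windowSum_sq_le`. Summation of the same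
  window sums over the lattice shows that the normalizing constants of the two blurs nearly agree
  (`exists_abs_sum_modSample_le`). Both bounds are combined in `exists_blur_bounds`.
* Gaussian shifts of bounded signal-to-noise ratio cannot be told apart. Since only finitely many
  coordinates are shifted, the likelihood ratio is a finite product (`lintegral_shift`), and by
  symmetry it exceeds a fixed constant with probability at least one half
  (`le_lintegral_add_lintegral_shift`).
-/

namespace BlurEstimation

/-! ### Characters, and a weight that is constant on unit cells -/

/-- The character `x ↦ exp(2πix)` of `ℝ`, with complex values. -/
noncomputable def unitExp (x : ℝ) : ℂ := Complex.exp (2 * Real.pi * x * Complex.I)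

lemma unitExp_add (x y : ℝ) : unitExp (x + y) = unitExp x * unitExp y := by
  simp only [unitExp, ← Complex.exp_add]; congr 1; push_cast; ring

@[simp] lemma unitExp_zero : unitExp 0 = 1 := by simp [unitExp]

@[simp] lemma norm_unitExp (x : ℝ) : ‖unitExp x‖ = 1 := by
  rw [unitExp, show (2 * Real.pi * x * Complex.I : ℂ) = ((2 * Real.pi * x : ℝ) : ℂ) * Complex.I by
    push_cast; ring, Complex.norm_exp_ofReal_mul_I]

lemma conj_unitExp (x : ℝ) : (starRingEnd ℂ) (unitExp x) = unitExp (-x) := by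
  rw [unitExp, unitExp, ← Complex.exp_conj]
  congr 1
  simp [map_ofNat (starRingEnd ℂ) 2]

lemma unitExp_intCast (k : ℤ) : unitExp k = 1 := by
  rw [unitExp, show (2 * Real.pi * ((k : ℝ) : ℂ) * Complex.I : ℂ) = k * (2 * Real.pi * Complex.I) by
    push_cast; ring, Complex.exp_int_mul_two_pi_mul_I]

lemma unitExp_sum {ι : Type*} (s : Finset ι) (x : ι → ℝ) :
    unitExp (∑ i ∈ s, x i) = ∏ i ∈ s, unitExp (x i) := by
  simp only [unitExp, ← Complex.exp_sum]
  congr 1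
  push_cast
  rw [Finset.mul_sum, Finset.sum_mul]

lemma continuous_unitExp : Continuous unitExp := by
  unfold unitExp; fun_prop

lemma re_unitExp (x : ℝ) : (unitExp x).re = Real.cos (2 * Real.pi * x) := by
  rw [unitExp, show (2 * Real.pi * x * Complex.I : ℂ) = ((2 * Real.pi * x : ℝ) : ℂ) * Complex.I by
    push_cast; ring, Complex.exp_ofReal_mul_I_re]

lemma norm_unitExp_sub_one_le (x : ℝ) : ‖unitExp x - 1‖ ≤ 2 * Real.pi * |x| := by
  have h := Real.norm_exp_I_mul_ofReal_sub_one_le (x := 2 * Real.pi * x)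
  rw [unitExp, show (2 * Real.pi * x * Complex.I : ℂ) = Complex.I * ((2 * Real.pi * x : ℝ) : ℂ) by
    push_cast; ring]
  refine h.trans ?_
  rw [Real.norm_eq_abs, abs_mul, abs_of_pos Real.two_pi_pos]

/-- A weight comparable to `(1 + y²)⁻¹` that is constant on the cells `[m, m + 1)`, so that it is
orthogonal to all nontrivial characters of period one. -/
noncomputable def cellWeight (y : ℝ) : ℝ := (1 + (⌊y⌋ : ℝ) ^ 2)⁻¹

lemma cellWeight_pos (y : ℝ) : 0 < cellWeight y := by unfold cellWeight; positivity

lemma measurable_cellWeight : Measurable cellWeight := by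
  unfold cellWeight
  have : Measurable fun y : ℝ => (⌊y⌋ : ℝ) := by fun_prop
  fun_prop

lemma floor_sq_bounds (y : ℝ) : (⌊y⌋ : ℝ) ^ 2 ≤ 2 * y ^ 2 + 2 ∧ y ^ 2 ≤ 2 * (⌊y⌋ : ℝ) ^ 2 + 2 := by
  have h1 := Int.floor_le y
  have h2 := Int.lt_floor_add_one y
  have h3 : (y - ⌊y⌋) ^ 2 ≤ 1 := by nlinarith
  constructor <;> nlinarith [sq_nonneg (y - 2 * ⌊y⌋), sq_nonneg (2 * y - ⌊y⌋)]

lemma cellWeight_le (y : ℝ) : cellWeight y ≤ 3 * (1 + y ^ 2)⁻¹ := by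
  unfold cellWeight
  rw [← div_eq_mul_inv, inv_eq_one_div, div_le_div_iff₀ (by positivity) (by positivity)]
  nlinarith [(floor_sq_bounds y).2]

lemma inv_cellWeight_le (y : ℝ) : (cellWeight y)⁻¹ ≤ 3 + 2 * y ^ 2 := by
  unfold cellWeight
  rw [inv_inv]
  nlinarith [(floor_sq_bounds y).1]

lemma integrable_cellWeight : Integrable cellWeight := by
  refine (integrable_inv_one_add_sq.const_mul 3).mono' measurable_cellWeight.aestronglyMeasurable ?_
  filter_upwards with y
  rw [Real.norm_eq_abs, abs_of_pos (cellWeight_pos y)]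
  exact cellWeight_le y

/-- The total mass of the weight `cellWeight`. -/
noncomputable def cellMass : ℝ := ∫ y, cellWeight y

lemma cellMass_pos : 0 < cellMass := by
  unfold cellMass
  rw [integral_pos_iff_support_of_nonneg (fun y => (cellWeight_pos y).le) integrable_cellWeight]
  rw [show Function.support cellWeight = Set.univ from
    Set.eq_univ_of_forall fun y => (cellWeight_pos y).ne']
  simp

lemma integrable_cellWeight_mul_unitExp (k : ℝ) :
    Integrable fun y : ℝ => (cellWeight y : ℂ) * unitExp (y * k) := by
  refine integrable_cellWeight.mono' ?_ ?_
  · have h1 := measurable_cellWeight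
    have h2 : Measurable fun y : ℝ => unitExp (y * k) :=
      (continuous_unitExp.comp (continuous_mul_const k)).measurable
    exact ((Complex.measurable_ofReal.comp h1).mul h2).aestronglyMeasurable
  · filter_upwards with y
    rw [norm_mul, norm_unitExp, mul_one, Complex.norm_real, Real.norm_eq_abs,
      abs_of_pos (cellWeight_pos y)]

lemma integral_unitExp_cell (k m : ℤ) (hk : k ≠ 0) :
    ∫ y in (m : ℝ)..(m + 1), unitExp (y * k) = 0 := by
  have hc : (2 * Real.pi * k * Complex.I : ℂ) ≠ 0 := by
    simp [Real.pi_ne_zero, hk]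
  have : ∀ y : ℝ, unitExp (y * k) = Complex.exp ((2 * Real.pi * k * Complex.I) * y) := by
    intro y; unfold unitExp; congr 1; push_cast; ring
  simp_rw [this]
  rw [integral_exp_mul_complex hc]
  have e1 := unitExp_intCast (k * m)
  have e2 := unitExp_intCast (k * (m + 1))
  unfold unitExp at e1 e2
  rw [show (2 * Real.pi * k * Complex.I : ℂ) * ((m : ℝ) : ℂ) =
    2 * Real.pi * (((k * m : ℤ) : ℝ) : ℂ) * Complex.I by push_cast; ring, e1,
    show (2 * Real.pi * k * Complex.I : ℂ) * ((m + 1 : ℝ) : ℂ) =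
    2 * Real.pi * (((k * (m + 1) : ℤ) : ℝ) : ℂ) * Complex.I by push_cast; ring, e2]
  simp

lemma integral_cellWeight_mul_unitExp (k : ℤ) (hk : k ≠ 0) :
    ∫ y : ℝ, (cellWeight y : ℂ) * unitExp (y * k) = 0 := by
  have hi := integrable_cellWeight_mul_unitExp (k : ℝ)
  rw [← setIntegral_univ, ← iUnion_Ico_intCast ℝ, integral_iUnion (fun i => measurableSet_Ico)
    (Set.pairwise_disjoint_Ico_intCast ℝ) hi.integrableOn]
  refine (tsum_congr fun m => ?_).trans tsum_zero
  have : ∫ y in Set.Ico (m : ℝ) (m + 1), (cellWeight y : ℂ) * unitExp (y * k)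
      = ∫ y in Set.Ico (m : ℝ) (m + 1), (((1 + (m : ℝ) ^ 2)⁻¹ : ℝ) : ℂ) * unitExp (y * k) := by
    refine setIntegral_congr_fun measurableSet_Ico fun y hy => ?_
    have : ⌊y⌋ = m := Int.floor_eq_iff.2 hy
    simp only [cellWeight, this]
  rw [this, integral_const_mul, integral_Ico_eq_integral_Ioc,
    ← intervalIntegral.integral_of_le (by linarith), integral_unitExp_cell k m hk, mul_zero]

variable {d : ℕ}

/-- Characters of `ℝ^d` with lattice frequencies are orthogonal for the product weight. -/
lemma integral_prod_cellWeight_mul_unitExp (h : ℝ) (hh : 0 < h) (k : Fin d → ℤ) :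
    ∫ w : Fin d → ℝ, ((∏ l, cellWeight (h * w l) : ℝ) : ℂ) * unitExp (∑ l, h * w l * k l)
      = if k = 0 then (((cellMass / h) ^ d : ℝ) : ℂ) else 0 := by
  have h1 : ∀ w : Fin d → ℝ,
      ((∏ l, cellWeight (h * w l) : ℝ) : ℂ) * unitExp (∑ l, h * w l * k l)
        = ∏ l, (fun y : ℝ => (cellWeight (h * y) : ℂ) * unitExp (h * y * k l)) (w l) := by
    intro w
    rw [unitExp_sum, Complex.ofReal_prod, ← Finset.prod_mul_distrib]
  simp_rw [h1]
  rw [integral_fintype_prod_volume_eq_prod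
    (f := fun l (y : ℝ) => (cellWeight (h * y) : ℂ) * unitExp (h * y * k l))]
  have h2 : ∀ l, ∫ y : ℝ, (cellWeight (h * y) : ℂ) * unitExp (h * y * k l)
      = if k l = 0 then ((cellMass / h : ℝ) : ℂ) else 0 := by
    intro l
    rw [Measure.integral_comp_mul_left (fun y : ℝ => (cellWeight y : ℂ) * unitExp (y * k l))]
    split_ifs with hk
    · simp only [hk, Int.cast_zero, mul_zero, unitExp_zero, mul_one]
      rw [integral_complex_ofReal, abs_of_pos (inv_pos.2 hh)]
      change _ • ((cellMass : ℝ) : ℂ) = _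
      rw [Complex.real_smul, ← Complex.ofReal_mul, div_eq_inv_mul]
    · rw [integral_cellWeight_mul_unitExp _ hk, smul_zero]
  simp_rw [h2]
  split_ifs with hk
  · simp [hk, div_pow]
  · obtain ⟨l, hl⟩ : ∃ l, k l ≠ 0 := by
      by_contra! hcon
      exact hk (funext hcon)
    exact Finset.prod_eq_zero (Finset.mem_univ l) (by simp [hl])

lemma integrable_prod_cellWeight (h : ℝ) (hh : 0 < h) :
    Integrable fun w : Fin d → ℝ => ∏ l, cellWeight (h * w l) :=
  Integrable.fintype_prod (f := fun _ (y : ℝ) => cellWeight (h * y))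
    fun _ => integrable_cellWeight.comp_mul_left' hh.ne'

lemma measurable_unitExp_sum (h : ℝ) (k : Fin d → ℤ) :
    Measurable fun w : Fin d → ℝ => unitExp (∑ l, h * w l * k l) :=
  (continuous_unitExp.comp (by fun_prop)).measurable

lemma integrable_prod_cellWeight_mul_unitExp (h : ℝ) (hh : 0 < h) (k : Fin d → ℤ) :
    Integrable fun w : Fin d → ℝ =>
      ((∏ l, cellWeight (h * w l) : ℝ) : ℂ) * unitExp (∑ l, h * w l * k l) := by
  refine (integrable_prod_cellWeight h hh).mono' ?_ ?_
  · exact (Complex.measurable_ofReal.comp_aemeasurable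
      (integrable_prod_cellWeight h hh).aemeasurable).aestronglyMeasurable.mul
      (measurable_unitExp_sum h k).aestronglyMeasurable
  · filter_upwards with w
    rw [norm_mul, norm_unitExp, mul_one, Complex.norm_real, Real.norm_eq_abs, abs_of_nonneg]
    exact Finset.prod_nonneg fun l _ => (cellWeight_pos _).le

/-- A trigonometric polynomial on `ℝ^d`, with frequencies in `h ℤ^d`. -/
noncomputable def trigPoly (J : Finset (Fin d → ℤ)) (c : (Fin d → ℤ) → ℂ) (h : ℝ)
    (w : Fin d → ℝ) : ℂ :=
  ∑ j ∈ J, c j * unitExp (∑ l, h * w l * j l)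

lemma normSq_trigPoly_mul (J : Finset (Fin d → ℤ)) (c : (Fin d → ℤ) → ℂ) (h : ℝ)
    (w : Fin d → ℝ) :
    ((‖trigPoly J c h w‖ ^ 2 * ∏ l, cellWeight (h * w l) : ℝ) : ℂ)
      = ∑ j ∈ J, ∑ j' ∈ J, (c j * (starRingEnd ℂ) (c j')) *
          (((∏ l, cellWeight (h * w l) : ℝ) : ℂ) * unitExp (∑ l, h * w l * (j - j') l)) := by
  push_cast
  rw [← Complex.mul_conj', trigPoly, map_sum, Finset.sum_mul_sum, Finset.sum_mul]
  refine Finset.sum_congr rfl fun j _ => ?_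
  rw [Finset.sum_mul]
  refine Finset.sum_congr rfl fun j' _ => ?_
  rw [map_mul, conj_unitExp]
  have : ∑ l, h * w l * ((j - j') l : ℤ) = (∑ l, h * w l * j l) + -(∑ l, h * w l * j' l) := by
    rw [← sub_eq_add_neg, ← Finset.sum_sub_distrib]
    refine Finset.sum_congr rfl fun l _ => ?_
    simp only [Pi.sub_apply]; push_cast; ring
  rw [this, unitExp_add]
  ring

lemma integrable_normSq_trigPoly_mul (J : Finset (Fin d → ℤ)) (c : (Fin d → ℤ) → ℂ) (h : ℝ)
    (hh : 0 < h) :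
    Integrable fun w : Fin d → ℝ => ‖trigPoly J c h w‖ ^ 2 * ∏ l, cellWeight (h * w l) := by
  have : Integrable fun w : Fin d → ℝ =>
      ((‖trigPoly J c h w‖ ^ 2 * ∏ l, cellWeight (h * w l) : ℝ) : ℂ) := by
    simp_rw [normSq_trigPoly_mul]
    exact integrable_finsetSum _ fun j _ => integrable_finsetSum _ fun j' _ =>
      (integrable_prod_cellWeight_mul_unitExp h hh _).const_mul _
  exact this.re

/-- Parseval's identity for the product weight. -/
lemma integral_normSq_trigPoly_mul (J : Finset (Fin d → ℤ)) (c : (Fin d → ℤ) → ℂ) (h : ℝ)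
    (hh : 0 < h) :
    ∫ w : Fin d → ℝ, ‖trigPoly J c h w‖ ^ 2 * ∏ l, cellWeight (h * w l)
      = (cellMass / h) ^ d * ∑ j ∈ J, ‖c j‖ ^ 2 := by
  apply Complex.ofReal_injective
  rw [← integral_complex_ofReal]
  simp_rw [normSq_trigPoly_mul]
  rw [integral_finsetSum _ fun j _ => integrable_finsetSum _ fun j' _ =>
      (integrable_prod_cellWeight_mul_unitExp h hh _).const_mul _]
  have : ∀ j ∈ J, ∫ w : Fin d → ℝ, ∑ j' ∈ J, (c j * (starRingEnd ℂ) (c j')) *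
      (((∏ l, cellWeight (h * w l) : ℝ) : ℂ) * unitExp (∑ l, h * w l * (j - j') l))
      = (c j * (starRingEnd ℂ) (c j)) * (((cellMass / h) ^ d : ℝ) : ℂ) := by
    intro j hj
    rw [integral_finsetSum _ fun j' _ =>
      (integrable_prod_cellWeight_mul_unitExp h hh _).const_mul _]
    simp_rw [integral_const_mul, integral_prod_cellWeight_mul_unitExp h hh]
    rw [Finset.sum_eq_single j]
    · simp
    · intro j' _ hne
      rw [if_neg (sub_ne_zero.2 hne.symm), mul_zero]
    · exact fun hcon => absurd hj hcon
  rw [Finset.sum_congr rfl this, ← Finset.sum_mul]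
  simp_rw [Complex.mul_conj']
  push_cast
  ring

/-! ### The box kernel -/

/-- Over a full period the values of a nontrivial character sum to zero. -/
lemma sum_unitExp_div_eq_zero (a : ℤ) (m : ℕ) (hm : 2 ≤ m) :
    ∑ k ∈ Finset.Icc a (a + m - 1), unitExp (-(1 / m * k)) = 0 := by
  have hm0 : (m : ℂ) ≠ 0 := by exact_mod_cast (by omega : m ≠ 0)
  have hprim := (Complex.isPrimitiveRoot_exp m (by omega)).inv
  have hg := hprim.geom_sum_eq_zero (by omega)
  have hI : Finset.Icc a (a + m - 1) = (Finset.range m).image (fun i : ℕ => a + (i : ℤ)) := by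
    ext k
    simp only [Finset.mem_Icc, Finset.mem_image, Finset.mem_range]
    constructor
    · rintro ⟨h1, h2⟩
      exact ⟨(k - a).toNat, by omega, by omega⟩
    · rintro ⟨i, hi, rfl⟩
      omega
  rw [hI, Finset.sum_image (fun x _ y _ hxy => by simpa using hxy)]
  have : ∀ i : ℕ, unitExp (-(1 / m * ((a + i : ℤ) : ℝ))) =
      unitExp (-(1 / m * a)) * (Complex.exp (2 * Real.pi * Complex.I / m))⁻¹ ^ i := by
    intro i
    rw [← Complex.exp_neg, ← Complex.exp_nat_mul, unitExp, unitExp, ← Complex.exp_add]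
    congr 1
    push_cast
    field_simp
    ring
  simp_rw [this]
  rw [← Finset.mul_sum, hg, mul_zero]

lemma card_Icc_add_sub_one (a : ℤ) (m : ℕ) : (Finset.Icc a (a + m - 1)).card = m := by
  rw [Int.card_Icc]; omega

lemma norm_sum_unitExp_le (a : ℤ) (m : ℕ) (y : ℝ) :
    ‖∑ k ∈ Finset.Icc a (a + m - 1), unitExp (-((y + 1 / m) * k))‖ ≤ m := by
  refine (norm_sum_le _ _).trans ?_
  simp

lemma norm_sum_unitExp_le_mul (a : ℤ) (m : ℕ) (hm : 2 ≤ m) (y : ℝ) :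
    ‖∑ k ∈ Finset.Icc a (a + m - 1), unitExp (-((y + 1 / m) * k))‖
      ≤ 2 * Real.pi * m ^ 2 * |y| := by
  -- the phase is normalized at the corner `a`, so that the remaining frequencies are below `m`
  have h0 : ∑ k ∈ Finset.Icc a (a + m - 1), unitExp (-((y + 1 / m) * k))
      = unitExp (-(y * a)) * ∑ k ∈ Finset.Icc a (a + m - 1),
          (unitExp (-(y * (k - a))) - 1) * unitExp (-(1 / m * k)) := by
    have : ∀ k : ℤ, (unitExp (-(y * (k - a))) - 1) * unitExp (-(1 / m * k))
        = unitExp (-(y * (k - a))) * unitExp (-(1 / m * k)) - unitExp (-(1 / m * k)) :=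
      fun k => by ring
    simp_rw [this]
    rw [Finset.sum_sub_distrib, sum_unitExp_div_eq_zero a m hm, sub_zero, Finset.mul_sum]
    refine Finset.sum_congr rfl fun k _ => ?_
    rw [← mul_assoc, ← unitExp_add, ← unitExp_add]
    congr 1
    ring
  rw [h0, norm_mul, norm_unitExp, one_mul]
  refine (norm_sum_le _ _).trans ?_
  have : ∀ k ∈ Finset.Icc a (a + m - 1),
      ‖(unitExp (-(y * (k - a))) - 1) * unitExp (-(1 / m * k))‖ ≤ 2 * Real.pi * (m * |y|) := by
    intro k hk
    rw [Finset.mem_Icc] at hk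
    rw [norm_mul, norm_unitExp, mul_one]
    refine (norm_unitExp_sub_one_le _).trans ?_
    have h1 : |(k : ℝ) - a| ≤ m := by
      have h2 : (a : ℝ) ≤ k := by exact_mod_cast hk.1
      have h3 : (k : ℝ) ≤ a + m - 1 := by exact_mod_cast hk.2
      rw [abs_of_nonneg (by linarith)]; linarith
    rw [abs_neg, abs_mul, mul_comm |y|]
    have := abs_nonneg y
    have := Real.pi_pos
    gcongr
  refine (Finset.sum_le_sum this).trans ?_
  rw [Finset.sum_const, card_Icc_add_sub_one, nsmul_eq_mul]
  apply le_of_eq; ring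

lemma normSq_sum_unitExp_le (a : ℤ) (m : ℕ) (hm : 2 ≤ m) (y : ℝ) :
    ‖∑ k ∈ Finset.Icc a (a + m - 1), unitExp (-((y + 1 / m) * k))‖ ^ 2
      ≤ 200 * m ^ 4 * y ^ 2 * cellWeight y := by
  set s := ‖∑ k ∈ Finset.Icc a (a + m - 1), unitExp (-((y + 1 / m) * k))‖
  have hs0 : 0 ≤ s := norm_nonneg _
  have h1 : s ≤ m := norm_sum_unitExp_le a m y
  have h2 : s ≤ 2 * Real.pi * m ^ 2 * |y| := norm_sum_unitExp_le_mul a m hm y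
  have hw := inv_cellWeight_le y
  have hm1 : (1 : ℝ) ≤ m := by exact_mod_cast (by omega : 1 ≤ m)
  suffices s ^ 2 * (cellWeight y)⁻¹ ≤ 200 * m ^ 4 * y ^ 2 by
    rwa [← div_eq_mul_inv, div_le_iff₀ (cellWeight_pos y)] at this
  refine (mul_le_mul_of_nonneg_left hw (sq_nonneg s)).trans ?_
  rcases le_total |y| 1 with hy | hy
  · have hy2 : y ^ 2 ≤ 1 := by rw [← sq_abs]; nlinarith [abs_nonneg y]
    have hpi : (2 * Real.pi) ^ 2 ≤ 40 := by nlinarith [Real.pi_lt_d2, Real.pi_pos]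
    calc s ^ 2 * (3 + 2 * y ^ 2) ≤ (2 * Real.pi * m ^ 2 * |y|) ^ 2 * 5 := by
          gcongr; linarith
      _ = (2 * Real.pi) ^ 2 * (m ^ 4 * y ^ 2 * 5) := by
          rw [mul_pow, mul_pow, sq_abs]; ring
      _ ≤ 40 * (m ^ 4 * y ^ 2 * 5) := by gcongr
      _ = 200 * m ^ 4 * y ^ 2 := by ring
  · have hy2 : 1 ≤ y ^ 2 := by rw [← sq_abs]; nlinarith [abs_nonneg y]
    calc s ^ 2 * (3 + 2 * y ^ 2) ≤ (m : ℝ) ^ 2 * (5 * y ^ 2) := by gcongr; linarith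
      _ ≤ (m : ℝ) ^ 4 * (200 * y ^ 2) := by
          gcongr <;> norm_num
      _ = 200 * m ^ 4 * y ^ 2 := by ring

lemma norm_boxKernel_sq_le (a : Fin d → ℤ) (m : Fin d → ℕ) (hm : ∀ l, 2 ≤ m l) (h : ℝ)
    (w : Fin d → ℝ) :
    ‖∑ k ∈ Finset.Icc a (fun l => a l + m l - 1), unitExp (-∑ l, (h * w l + 1 / m l) * k l)‖ ^ 2
      ≤ (200 ^ d * (∏ l, (m l : ℝ) ^ 4) * h ^ (2 * d) * ∏ l, w l ^ 2) *
        ∏ l, cellWeight (h * w l) := by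
  have h1 : ∑ k ∈ Finset.Icc a (fun l => a l + m l - 1),
      unitExp (-∑ l, (h * w l + 1 / m l) * k l)
      = ∏ l, ∑ k ∈ Finset.Icc (a l) (a l + m l - 1), unitExp (-((h * w l + 1 / m l) * k)) := by
    rw [Finset.prod_univ_sum]
    refine Finset.sum_congr rfl fun k _ => ?_
    rw [← Finset.sum_neg_distrib, unitExp_sum]
  rw [h1, norm_prod, ← Finset.prod_pow]
  refine (Finset.prod_le_prod (fun l _ => sq_nonneg _)
    fun l _ => normSq_sum_unitExp_le (a l) (m l) (hm l) (h * w l)).trans (le_of_eq ?_)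
  simp_rw [mul_pow]
  simp only [Finset.prod_mul_distrib, Finset.prod_const, Finset.card_univ, Fintype.card_fin]
  rw [← pow_mul]
  ring

/-- The windowed and modulated lattice samples of `g`, namely
`∑_{k ∈ box} g(h(j - k)) exp(2πi ∑_l (j_l - k_l)/m_l)`, the box having sides `m_l` and lowest
corner `a`. -/
noncomputable def windowSum (g : (Fin d → ℝ) → ℂ) (a : Fin d → ℤ) (m : Fin d → ℕ) (h : ℝ)
    (j : Fin d → ℤ) : ℂ :=
  ∑ k ∈ Finset.Icc a (fun l => a l + m l - 1),
    g (fun l => h * (j l - k l)) * unitExp (∑ l, 1 / (m l : ℝ) * (j l - k l))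

lemma integrable_mul_unitExp {G : (Fin d → ℝ) → ℂ} (hG : Integrable G)
    {φ : (Fin d → ℝ) → ℝ} (hφ : Continuous φ) : Integrable fun w => G w * unitExp (φ w) := by
  refine hG.mul_bdd (c := 1) ?_ ?_
  · exact (continuous_unitExp.comp hφ).aestronglyMeasurable
  · filter_upwards with w; simp

/-- If `g` is the inverse Fourier transform of `G`, then the mean-square size of the window sums
is controlled by the mixed derivative of `g`: the modulation annihilates constants in each
coordinate, which gains one derivative per coordinate. -/
theorem sum_norm_windowSum_sq_le {G g : (Fin d → ℝ) → ℂ} (hG : Integrable G)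
    (hg : ∀ x, g x = ∫ w, G w * unitExp (∑ l, w l * x l))
    (hG2 : Integrable fun w : Fin d → ℝ => ‖G w‖ ^ 2 * ∏ l, w l ^ 2)
    (a : Fin d → ℤ) (m : Fin d → ℕ) (hm : ∀ l, 2 ≤ m l) {h : ℝ} (hh : 0 < h)
    (J : Finset (Fin d → ℤ)) :
    ∑ j ∈ J, ‖windowSum g a m h j‖ ^ 2
      ≤ (200 * cellMass) ^ d * (∫ w : Fin d → ℝ, ‖G w‖ ^ 2 * ∏ l, w l ^ 2) *
        (∏ l, (m l : ℝ) ^ 4) * h ^ d := by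
  set D := windowSum g a m h with hD
  set K : (Fin d → ℝ) → ℂ := fun w => ∑ k ∈ Finset.Icc a (fun l => a l + m l - 1),
    unitExp (-∑ l, (h * w l + 1 / m l) * k l) with hK
  set B := ∫ w : Fin d → ℝ, ‖G w‖ ^ 2 * ∏ l, w l ^ 2 with hB
  set M := 200 ^ d * (∏ l, (m l : ℝ) ^ 4) * h ^ (2 * d) with hM
  set Q := ∑ j ∈ J, ‖D j‖ ^ 2 with hQ
  set ε := (cellMass / h) ^ d with hε
  have hε0 : 0 < ε := pow_pos (div_pos cellMass_pos hh) d
  have hM0 : 0 ≤ M := by positivity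
  let c : (Fin d → ℤ) → ℂ := fun j => (starRingEnd ℂ) (D j) * unitExp (∑ l, 1 / (m l : ℝ) * j l)
  have hterm : ∀ j, D j = ∫ w, G w * K w * unitExp (∑ l, (h * w l + 1 / (m l : ℝ)) * j l) := by
    intro j
    rw [hD, windowSum]
    have h1 : ∀ k : Fin d → ℤ, g (fun l => h * (j l - k l)) *
        unitExp (∑ l, 1 / (m l : ℝ) * (j l - k l)) = ∫ w, G w *
          unitExp (∑ l, (h * w l + 1 / (m l : ℝ)) * (j l - k l)) := by
      intro k
      rw [hg, ← integral_mul_const]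
      congr 1
      ext w
      rw [mul_assoc, ← unitExp_add, ← Finset.sum_add_distrib]
      congr 2
      refine Finset.sum_congr rfl fun l _ => ?_
      ring
    simp_rw [h1]
    rw [← integral_finsetSum _ fun k _ => integrable_mul_unitExp hG (by fun_prop)]
    congr 1
    ext w
    rw [← Finset.mul_sum, mul_assoc, hK, Finset.sum_mul]
    congr 1
    refine Finset.sum_congr rfl fun k _ => ?_
    rw [← unitExp_add]
    congr 1
    rw [← Finset.sum_neg_distrib, ← Finset.sum_add_distrib]
    refine Finset.sum_congr rfl fun l _ => ?_
    ring
  have hKint : ∀ j : Fin d → ℤ, Integrable fun w : Fin d → ℝ =>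
      G w * K w * unitExp (∑ l, (h * w l + 1 / (m l : ℝ)) * j l) := by
    intro j
    refine integrable_mul_unitExp ?_ (by fun_prop)
    simp_rw [hK, Finset.mul_sum]
    exact integrable_finsetSum _ fun k _ => integrable_mul_unitExp hG (by fun_prop)
  have hQint : (Q : ℂ) = ∫ w, G w * K w * trigPoly J c h w := by
    rw [hQ]
    push_cast
    have h1 : ∀ j ∈ J, ((‖D j‖ : ℂ)) ^ 2 = ∫ w, (starRingEnd ℂ) (D j) *
        (G w * K w * unitExp (∑ l, (h * w l + 1 / (m l : ℝ)) * j l)) := by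
      intro j _
      rw [integral_const_mul, ← hterm, Complex.conj_mul']
    rw [Finset.sum_congr rfl h1, ← integral_finsetSum _ fun j _ => (hKint j).const_mul _]
    congr 1
    ext w
    rw [trigPoly, Finset.mul_sum J]
    refine Finset.sum_congr rfl fun j _ => ?_
    have : ∑ l, (h * w l + 1 / (m l : ℝ)) * j l
        = ∑ l, 1 / (m l : ℝ) * j l + ∑ l, h * w l * j l := by
      rw [← Finset.sum_add_distrib]
      refine Finset.sum_congr rfl fun l _ => ?_
      ring
    rw [this, unitExp_add]
    ring
  have hQ0 : 0 ≤ Q := Finset.sum_nonneg fun _ _ => sq_nonneg _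
  have hcn : ∑ j ∈ J, ‖c j‖ ^ 2 = Q := by
    refine Finset.sum_congr rfl fun j _ => ?_
    simp [c]
  have hbound : Q ≤ ∫ w : Fin d → ℝ, (ε * M / 2 * (‖G w‖ ^ 2 * ∏ l, w l ^ 2) +
      ε⁻¹ / 2 * (‖trigPoly J c h w‖ ^ 2 * ∏ l, cellWeight (h * w l))) := by
    have hQn : Q = ‖(Q : ℂ)‖ := by rw [Complex.norm_real, Real.norm_eq_abs, abs_of_nonneg hQ0]
    rw [hQn, hQint]
    refine norm_integral_le_of_norm_le
      ((hG2.const_mul _).add ((integrable_normSq_trigPoly_mul J c h hh).const_mul _)) ?_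
    filter_upwards with w
    rw [norm_mul, norm_mul]
    set T := ‖trigPoly J c h w‖
    set W := ∏ l, cellWeight (h * w l) with hW
    have hW0 : 0 < W := Finset.prod_pos fun l _ => cellWeight_pos _
    have hKb : ‖K w‖ ^ 2 ≤ M * (∏ l, w l ^ 2) * W := norm_boxKernel_sq_le a m hm h w
    have hKW : ‖K w‖ ^ 2 / W ≤ M * ∏ l, w l ^ 2 := by rwa [div_le_iff₀ hW0]
    -- the arithmetic-geometric mean inequality, balanced by the constant `ε`
    have hamgm : ‖G w‖ * ‖K w‖ * T
        ≤ ε / 2 * (‖G w‖ ^ 2 * (‖K w‖ ^ 2 / W)) + ε⁻¹ / 2 * (T ^ 2 * W) := by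
      have key : ε / 2 * (‖G w‖ ^ 2 * (‖K w‖ ^ 2 / W)) + ε⁻¹ / 2 * (T ^ 2 * W)
          - ‖G w‖ * ‖K w‖ * T = (ε * W)⁻¹ / 2 * (ε * (‖G w‖ * ‖K w‖) - T * W) ^ 2 := by
        field_simp
        ring
      have : 0 ≤ (ε * W)⁻¹ / 2 * (ε * (‖G w‖ * ‖K w‖) - T * W) ^ 2 := by positivity
      linarith
    refine hamgm.trans (add_le_add_left ?_ _)
    calc ε / 2 * (‖G w‖ ^ 2 * (‖K w‖ ^ 2 / W))
        ≤ ε / 2 * (‖G w‖ ^ 2 * (M * ∏ l, w l ^ 2)) := by gcongr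
      _ = _ := by ring
  rw [integral_add (hG2.const_mul _) ((integrable_normSq_trigPoly_mul J c h hh).const_mul _),
    integral_const_mul, integral_const_mul, integral_normSq_trigPoly_mul J c h hh, hcn, ← hε,
    ← hB] at hbound
  have h3 : ε⁻¹ / 2 * (ε * Q) = Q / 2 := by field_simp
  rw [h3] at hbound
  have h4 : Q ≤ ε * M * B := by linarith
  refine h4.trans (le_of_eq ?_)
  rw [hε, hM, div_pow, mul_pow, show h ^ (2 * d) = h ^ d * h ^ d by rw [two_mul, pow_add]]
  field_simp

/-! ### Window sums of a profile with decaying Fourier transform -/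

/-- The profile as a complex function of coordinates. -/
noncomputable def coordProfile (f : EuclideanSpace ℝ (Fin d) → ℝ) (x : Fin d → ℝ) : ℂ :=
  (f (WithLp.toLp 2 x) : ℂ)

open FourierTransform in
lemma fourier_eq_ft (f : EuclideanSpace ℝ (Fin d) → ℝ) (w : EuclideanSpace ℝ (Fin d)) :
    𝓕 (fun x => (f x : ℂ)) w = ft f (-(2 * Real.pi) • w) := by
  rw [Real.fourier_eq', ft]
  congr 1
  ext v
  rw [smul_eq_mul, mul_comm]
  congr 2
  rw [inner_smul_left, real_inner_comm]
  push_cast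
  simp
  ring

lemma IsProfile.integrable {f : EuclideanSpace ℝ (Fin d) → ℝ} (hf : IsProfile f) :
    Integrable f :=
  hf.continuous.integrable_of_hasCompactSupport hf.hasCompactSupport

lemma FtDecay.exists_bound {f : EuclideanSpace ℝ (Fin d) → ℝ} {p : ℝ} (hp : FtDecay f p) :
    ∃ C > 0, ∀ t, ‖ft f t‖ ≤ C * (1 + ‖t‖) ^ (-p) := by
  obtain ⟨C, hC⟩ := hp
  refine ⟨max C 1, by positivity, fun t => ?_⟩
  have h1 : (1 + ‖t‖) ^ p * ‖ft f t‖ ≤ C := hC (Set.mem_range_self t)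
  have h2 : 0 < (1 + ‖t‖) ^ p := Real.rpow_pos_of_pos (by positivity) p
  rw [Real.rpow_neg (by positivity), ← div_eq_mul_inv, le_div_iff₀ h2, mul_comm]
  exact h1.trans (le_max_left _ _)

open FourierTransform in
lemma exists_fourier_bound {f : EuclideanSpace ℝ (Fin d) → ℝ} {p : ℝ} (hp0 : 0 ≤ p)
    (hp : FtDecay f p) :
    ∃ C > 0, ∀ w, ‖𝓕 (fun x => (f x : ℂ)) w‖ ≤ C * (1 + ‖w‖) ^ (-p) := by
  obtain ⟨C, hC0, hC⟩ := hp.exists_bound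
  refine ⟨C, hC0, fun w => ?_⟩
  rw [fourier_eq_ft]
  refine (hC _).trans ?_
  gcongr ?_ * ?_
  refine Real.rpow_le_rpow_of_nonpos (by positivity) ?_ (by linarith)
  rw [norm_smul, norm_neg, Real.norm_eq_abs, abs_of_pos Real.two_pi_pos]
  nlinarith [norm_nonneg w, Real.pi_gt_three]

lemma prod_sq_le_norm_pow (w : EuclideanSpace ℝ (Fin d)) :
    ∏ l, w l ^ 2 ≤ (1 + ‖w‖) ^ (2 * d) := by
  calc ∏ l, w l ^ 2 ≤ ∏ _l : Fin d, (1 + ‖w‖) ^ 2 := by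
        refine Finset.prod_le_prod (fun l _ => sq_nonneg _) fun l _ => ?_
        have := PiLp.norm_apply_le w l
        rw [Real.norm_eq_abs] at this
        rw [← sq_abs]
        gcongr
        linarith
    _ = _ := by simp [pow_mul]

open FourierTransform in
/-- The window sums of a profile at mesh size `h` have squared `ℓ²` norm of order
`h^d ∏ m_l⁴`. -/
theorem exists_sum_norm_windowSum_sq_le {f : EuclideanSpace ℝ (Fin d) → ℝ} {p : ℝ} (hd : 1 ≤ d)
    (hf : IsProfile f) (hfp : FtDecay f p) (hp : 3 / 2 * (d : ℝ) < p) :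
    ∃ C > 0, ∀ (a : Fin d → ℤ) (m : Fin d → ℕ), (∀ l, 2 ≤ m l) → ∀ h : ℝ, 0 < h →
      ∀ J : Finset (Fin d → ℤ),
        ∑ j ∈ J, ‖windowSum (coordProfile f) a m h j‖ ^ 2 ≤ C * (∏ l, (m l : ℝ) ^ 4) * h ^ d := by
  have hd1 : (1 : ℝ) ≤ d := by exact_mod_cast hd
  have hp0 : 0 ≤ p := by linarith
  obtain ⟨C, hC0, hC⟩ := exists_fourier_bound hp0 hfp
  have hfi : Integrable fun x => (f x : ℂ) := hf.integrable.ofReal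
  have hcont : Continuous (𝓕 (fun x => (f x : ℂ))) := 
    VectorFourier.fourierIntegral_continuous Real.continuous_fourierChar
      (by exact continuous_inner) hfi
  have hfin : Module.finrank ℝ (EuclideanSpace ℝ (Fin d)) = d := finrank_euclideanSpace_fin
  have hF1 : Integrable (𝓕 (fun x => (f x : ℂ))) := by
    refine ((integrable_one_add_norm (r := p) ?_).const_mul C).mono' hcont.aestronglyMeasurable
      (Eventually.of_forall hC)
    rw [hfin]; linarith
  have hF2 : Integrable fun w : EuclideanSpace ℝ (Fin d) =>
      ‖𝓕 (fun x => (f x : ℂ)) w‖ ^ 2 * ∏ l, w l ^ 2 := by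
    refine ((integrable_one_add_norm (r := 2 * p - 2 * d) ?_).const_mul (C ^ 2)).mono' ?_ ?_
    · rw [hfin]; linarith
    · have : Continuous fun w : EuclideanSpace ℝ (Fin d) =>
        ‖𝓕 (fun x => (f x : ℂ)) w‖ ^ 2 * ∏ l, w l ^ 2 := by fun_prop
      exact this.aestronglyMeasurable
    · filter_upwards with w
      rw [Real.norm_eq_abs, abs_of_nonneg (by positivity)]
      have h1 : 0 < 1 + ‖w‖ := by positivity
      calc ‖𝓕 (fun x => (f x : ℂ)) w‖ ^ 2 * ∏ l, w l ^ 2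
          ≤ (C * (1 + ‖w‖) ^ (-p)) ^ 2 * (1 + ‖w‖) ^ (2 * d) := by
            gcongr
            · exact hC w
            · exact prod_sq_le_norm_pow w
        _ = C ^ 2 * (1 + ‖w‖) ^ (-(2 * p - 2 * d)) := by
            rw [mul_pow, mul_assoc, ← Real.rpow_natCast, ← Real.rpow_natCast, ← Real.rpow_natCast,
              ← Real.rpow_mul h1.le, ← Real.rpow_add h1]
            congr 2
            push_cast; ring
  have hmp := PiLp.volume_preserving_toLp (Fin d)
  have hemb : MeasurableEmbedding (WithLp.toLp 2 : (Fin d → ℝ) → EuclideanSpace ℝ (Fin d)) :=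
    (MeasurableEquiv.toLp 2 (Fin d → ℝ)).measurableEmbedding
  set G : (Fin d → ℝ) → ℂ := fun w => 𝓕 (fun x => (f x : ℂ)) (WithLp.toLp 2 w) with hG
  have hG1 : Integrable G := hmp.integrable_comp_of_integrable hF1
  have hG2 : Integrable fun w : Fin d → ℝ => ‖G w‖ ^ 2 * ∏ l, w l ^ 2 :=
    hmp.integrable_comp_of_integrable hF2
  have hinv : ∀ x, coordProfile f x = ∫ w, G w * unitExp (∑ l, w l * x l) := by
    intro x
    have h1 := congrFun ((Complex.continuous_ofReal.comp hf.continuous).fourierInv_fourier_eq hfi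
      hF1) (WithLp.toLp 2 x)
    rw [Real.fourierInv_eq'] at h1
    rw [coordProfile]
    refine h1.symm.trans ?_
    rw [← hmp.integral_comp hemb]
    congr 1
    ext w
    rw [smul_eq_mul, mul_comm, hG]
    congr 1
    rw [unitExp]
    congr 1
    have : (⟪(WithLp.toLp 2 w : EuclideanSpace ℝ (Fin d)), WithLp.toLp 2 x⟫ : ℝ)
        = ∑ l, w l * x l := by
      simp [PiLp.inner_apply, mul_comm]
    rw [this]
    push_cast
    ring
  set B := ∫ w : Fin d → ℝ, ‖G w‖ ^ 2 * ∏ l, w l ^ 2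
  have hB : 0 ≤ B := integral_nonneg fun w => by positivity
  have hA := cellMass_pos
  refine ⟨(200 * cellMass) ^ d * (B + 1), by positivity, fun a m hm h hh J => ?_⟩
  refine (sum_norm_windowSum_sq_le hG1 hinv hG2 a m hm hh J).trans ?_
  gcongr
  linarith

/-! ### Shifts of independent Gaussian variables and the two-point bound -/

section Gaussian

open scoped NNReal

/-- The density of `N(c, v)` with respect to `N(0, v)`. -/
noncomputable def shiftDensity (v : ℝ≥0) (c x : ℝ) : ℝ≥0∞ :=
  ENNReal.ofReal (Real.exp ((c * x - c ^ 2 / 2) / v))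

lemma measurable_shiftDensity (v : ℝ≥0) (c : ℝ) : Measurable (shiftDensity v c) := by
  unfold shiftDensity; fun_prop

@[simp] lemma shiftDensity_zero (v : ℝ≥0) (x : ℝ) : shiftDensity v 0 x = 1 := by
  simp [shiftDensity]

lemma setLIntegral_shiftDensity {v : ℝ≥0} (hv : v ≠ 0) (c : ℝ) {t : Set ℝ}
    (ht : MeasurableSet t) :
    ∫⁻ x in t, shiftDensity v c x ∂(gaussianReal 0 v) = gaussianReal c v t := by
  rw [gaussianReal_of_var_ne_zero _ hv,
    setLIntegral_withDensity_eq_setLIntegral_mul _ (measurable_gaussianPDF 0 v)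
      (measurable_shiftDensity v c) ht, gaussianReal_apply _ hv]
  refine lintegral_congr fun x => ?_
  have hv' : (v : ℝ) ≠ 0 := by exact_mod_cast hv
  rw [Pi.mul_apply, gaussianPDF, shiftDensity, gaussianPDF,
    ← ENNReal.ofReal_mul (gaussianPDFReal_nonneg _ _ _)]
  congr 1
  simp only [gaussianPDFReal]
  rw [mul_assoc, ← Real.exp_add]
  congr 2
  field_simp
  ring

variable {ι Ω : Type*} [MeasurableSpace Ω] {P : Measure Ω} [IsProbabilityMeasure P]
  {X : ι → Ω → ℝ} {v : ℝ≥0}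

/-- The Cameron–Martin formula for a shift of finitely many coordinates. -/
lemma lintegral_shift (hX : ∀ i, Measurable (X i)) (hind : iIndepFun X P)
    (hlaw : ∀ i, P.map (X i) = gaussianReal 0 v) (hv : v ≠ 0) (J : Finset ι) (η : ι → ℝ)
    (hη : ∀ i ∉ J, η i = 0) {F : (ι → ℝ) → ℝ≥0∞} (hF : Measurable F) :
    ∫⁻ ω, F (fun i => X i ω + η i) ∂P
      = ∫⁻ ω, (∏ i ∈ J, shiftDensity v (η i) (X i ω)) * F (fun i => X i ω) ∂P := by
  classical
  have hXm : Measurable fun ω i => X i ω := measurable_pi_iff.2 hX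
  have hYm : ∀ i, Measurable fun ω => X i ω + η i := fun i => (hX i).add_const _
  have hLm : Measurable fun ω => ∏ i ∈ J, shiftDensity v (η i) (X i ω) :=
    Finset.measurable_prod _ fun i _ => (measurable_shiftDensity v _).comp (hX i)
  have hYind : iIndepFun (fun i ω => X i ω + η i) P :=
    hind.comp (fun i x => x + η i) fun i => measurable_add_const _
  have hYlaw : ∀ i, P.map (fun ω => X i ω + η i) = gaussianReal (η i) v := by
    intro i
    rw [← zero_add (η i), ← gaussianReal_map_add_const, ← hlaw i,
      Measure.map_map (measurable_add_const _) (hX i)]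
    simp [Function.comp_def]
  have h1 : P.map (fun ω i => X i ω + η i)
      = Measure.infinitePi fun i => gaussianReal (η i) v := by
    rw [(iIndepFun_iff_map_fun_eq_infinitePi_map hYm).1 hYind]
    simp_rw [hYlaw]
  have h2 : (P.withDensity fun ω => ∏ i ∈ J, shiftDensity v (η i) (X i ω)).map
      (fun ω i => X i ω) = Measure.infinitePi fun i => gaussianReal (η i) v := by
    refine Measure.eq_infinitePi _ fun s t ht => ?_
    have hst : MeasurableSet ((s : Set ι).pi t) :=
      MeasurableSet.pi s.countable_toSet fun i _ => ht i
    rw [Measure.map_apply hXm hst, withDensity_apply _ (hXm hst),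
      ← lintegral_indicator (hXm hst)]
    have h3 : ∀ ω, ((fun ω i => X i ω) ⁻¹' (s : Set ι).pi t).indicator
        (fun ω => ∏ i ∈ J, shiftDensity v (η i) (X i ω)) ω
        = ∏ i ∈ J ∪ s, (if i ∈ s then (t i).indicator (shiftDensity v (η i))
          else shiftDensity v (η i)) (X i ω) := by
      intro ω
      by_cases hω : ω ∈ (fun ω i => X i ω) ⁻¹' (s : Set ι).pi t
      · rw [Set.indicator_of_mem hω]
        have : ∀ i ∈ J ∪ s, (if i ∈ s then (t i).indicator (shiftDensity v (η i))
          else shiftDensity v (η i)) (X i ω) = shiftDensity v (η i) (X i ω) := by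
          intro i _
          split_ifs with his
          · exact Set.indicator_of_mem (hω i his) _
          · rfl
        rw [Finset.prod_congr rfl this]
        refine Finset.prod_subset Finset.subset_union_left fun i _ hi => ?_
        rw [hη i hi, shiftDensity_zero]
      · rw [Set.indicator_of_notMem hω]
        have : ∃ i ∈ s, X i ω ∉ t i := by
          by_contra! hcon
          exact hω fun i hi => hcon i hi
        obtain ⟨i, his, hit⟩ := this
        symm
        refine Finset.prod_eq_zero (Finset.mem_union_right _ his) ?_
        rw [if_pos his, Set.indicator_of_notMem hit]
    simp_rw [h3]
    have hgm : ∀ i, Measurable (if i ∈ s then (t i).indicator (shiftDensity v (η i))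
          else shiftDensity v (η i)) := by
      intro i
      split_ifs
      · exact (measurable_shiftDensity v _).indicator (ht i)
      · exact measurable_shiftDensity v _
    rw [lintegral_prod_eq_prod_lintegral_of_indepFun (J ∪ s)
      (fun i ω => (if i ∈ s then (t i).indicator (shiftDensity v (η i))
          else shiftDensity v (η i)) (X i ω)) (hind.comp _ hgm) fun i => (hgm i).comp (hX i)]
    have h4 : ∀ i, ∫⁻ ω, (if i ∈ s then (t i).indicator (shiftDensity v (η i))
          else shiftDensity v (η i)) (X i ω) ∂P
        = if i ∈ s then gaussianReal (η i) v (t i) else 1 := by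
      intro i
      rw [← lintegral_map (hgm i) (hX i), hlaw]
      split_ifs with his
      · rw [lintegral_indicator (ht i), setLIntegral_shiftDensity hv _ (ht i)]
      · rw [← setLIntegral_univ, setLIntegral_shiftDensity hv _ MeasurableSet.univ, measure_univ]
    simp_rw [h4]
    rw [Finset.prod_ite_mem]
    congr 1
    rw [Finset.inter_eq_right.2 Finset.subset_union_right]
  rw [← lintegral_map hF (measurable_pi_iff.2 hYm), h1, ← h2, lintegral_map hF hXm]
  exact lintegral_withDensity_eq_lintegral_mul _ hLm (hF.comp hXm)

/-- A linear combination of independent centred Gaussian variables is symmetric, so it is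
nonnegative with probability at least one half. -/
lemma half_le_measure_sum_nonneg (hX : ∀ i, Measurable (X i)) (hind : iIndepFun X P)
    (hlaw : ∀ i, P.map (X i) = gaussianReal 0 v) (J : Finset ι) (η : ι → ℝ) :
    (1 / 2 : ℝ≥0∞) ≤ P {ω | 0 ≤ ∑ i ∈ J, η i * X i ω} := by
  have hXm : Measurable fun ω i => X i ω := measurable_pi_iff.2 hX
  have hXneg : Measurable fun ω i => -X i ω := measurable_pi_iff.2 fun i => (hX i).neg
  have hsymm : P.map (fun ω i => -X i ω) = P.map (fun ω i => X i ω) := by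
    rw [(iIndepFun_iff_map_fun_eq_infinitePi_map (X := fun i ω => -X i ω)
      (fun i => (hX i).neg)).1 (hind.comp (fun _ x => -x) fun _ => measurable_neg),
      (iIndepFun_iff_map_fun_eq_infinitePi_map hX).1 hind]
    congr 1
    ext1 i
    have := gaussianReal_map_neg (μ := 0) (v := v)
    rw [neg_zero, ← hlaw i, Measure.map_map measurable_neg (hX i)] at this
    exact this
  have hm : MeasurableSet {x : ι → ℝ | 0 ≤ ∑ i ∈ J, η i * x i} :=
    measurableSet_le measurable_const
      (Finset.measurable_sum _ fun i _ => (measurable_pi_apply i).const_mul _)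
  have hle : P {ω | ∑ i ∈ J, η i * X i ω ≤ 0} = P {ω | 0 ≤ ∑ i ∈ J, η i * X i ω} := by
    have h := congrArg (fun μ : Measure (ι → ℝ) => μ {x : ι → ℝ | 0 ≤ ∑ i ∈ J, η i * x i}) hsymm
    simp only [Measure.map_apply hXneg hm, Measure.map_apply hXm hm] at h
    simpa [Set.preimage, Finset.sum_neg_distrib] using h
  have hun : (1 : ℝ≥0∞) ≤ P {ω | 0 ≤ ∑ i ∈ J, η i * X i ω}
      + P {ω | 0 ≤ ∑ i ∈ J, η i * X i ω} := by
    nth_rewrite 2 [← hle]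
    refine le_trans ?_ (measure_union_le _ _)
    rw [← measure_univ (μ := P)]
    exact measure_mono fun ω _ => le_total 0 (∑ i ∈ J, η i * X i ω)
  rw [← two_mul] at hun
  rw [one_div]
  exact ENNReal.inv_le_iff_le_mul (by simp) (by simp) |>.2 hun

/-- Le Cam's two-point bound: no decision rule has small loss under both the noise `X` and the
shifted noise `X + η`, when the squared signal-to-noise ratio of `η` is at most `M`. -/
theorem le_lintegral_add_lintegral_shift (hX : ∀ i, Measurable (X i)) (hind : iIndepFun X P)
    (hlaw : ∀ i, P.map (X i) = gaussianReal 0 v) (hv : v ≠ 0) (J : Finset ι) (η : ι → ℝ)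
    (hη : ∀ i ∉ J, η i = 0) {M : ℝ} (hM : ∑ i ∈ J, η i ^ 2 ≤ M * v)
    {F₀ F₁ : (ι → ℝ) → ℝ≥0∞} (hF₀ : Measurable F₀) (hF₁ : Measurable F₁) {κ : ℝ≥0∞}
    (hκ : ∀ y, κ ≤ F₀ y + F₁ y) :
    ENNReal.ofReal (Real.exp (-M / 2)) * κ / 2
      ≤ ∫⁻ ω, F₀ (fun i => X i ω) ∂P + ∫⁻ ω, F₁ (fun i => X i ω + η i) ∂P := by
  have hXm : Measurable fun ω i => X i ω := measurable_pi_iff.2 hX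
  have hv0 : (0 : ℝ) < v := by exact_mod_cast pos_iff_ne_zero.2 hv
  have hM0 : 0 ≤ M := by
    by_contra! hcon
    have h1 : 0 ≤ ∑ i ∈ J, η i ^ 2 := Finset.sum_nonneg fun _ _ => sq_nonneg _
    nlinarith
  set E := {ω | 0 ≤ ∑ i ∈ J, η i * X i ω} with hE
  have hEm : MeasurableSet E := measurableSet_le measurable_const
      (Finset.measurable_sum _ fun i _ => (hX i).const_mul _)
  have hE2 := half_le_measure_sum_nonneg hX hind hlaw J η
  rw [← hE] at hE2
  rw [lintegral_shift hX hind hlaw hv J η hη hF₁]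
  have hF₀X : Measurable fun ω => F₀ fun i => X i ω := hF₀.comp hXm
  rw [← lintegral_add_left hF₀X]
  set c := ENNReal.ofReal (Real.exp (-M / 2)) with hc
  have hc1 : c ≤ 1 := by
    rw [hc, ← ENNReal.ofReal_one]
    exact ENNReal.ofReal_le_ofReal (Real.exp_le_one_iff.2 (by linarith))
  calc c * κ / 2 = c * κ * (1 / 2) := by rw [div_eq_mul_inv, one_div]
    _ ≤ c * κ * P E := by gcongr
    _ = ∫⁻ ω in E, c * κ ∂P := by rw [setLIntegral_const]
    _ ≤ ∫⁻ ω in E, F₀ (fun i => X i ω)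
          + (∏ i ∈ J, shiftDensity v (η i) (X i ω)) * F₁ (fun i => X i ω) ∂P := by
        refine setLIntegral_mono' hEm fun ω hω => ?_
        have hL : c ≤ ∏ i ∈ J, shiftDensity v (η i) (X i ω) := by
          unfold shiftDensity
          rw [← ENNReal.ofReal_prod_of_nonneg fun _ _ => (Real.exp_pos _).le, ← Real.exp_sum]
          refine ENNReal.ofReal_le_ofReal (Real.exp_le_exp.2 ?_)
          rw [← Finset.sum_div, le_div_iff₀ hv0, Finset.sum_sub_distrib, ← Finset.sum_div]
          have : 0 ≤ ∑ i ∈ J, η i * X i ω := hω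
          linarith
        calc c * κ ≤ c * (F₀ (fun i => X i ω) + F₁ (fun i => X i ω)) := by
              gcongr; exact hκ _
          _ = c * F₀ (fun i => X i ω) + c * F₁ (fun i => X i ω) := mul_add _ _ _
          _ ≤ _ := by
              gcongr
              exact mul_le_of_le_one_left' hc1
    _ ≤ _ := setLIntegral_le_lintegral _ _

end Gaussian

/-! ### Counting lattice points -/

section Lattice

/-- The lattice points `j` for which `h j` lies in the cube with centre `x` and half-side `r`. -/
noncomputable def latticeCube (x : Fin d → ℝ) (r h : ℝ) : Finset (Fin d → ℤ) :=
  Finset.Icc (fun l => ⌈(x l - r) / h⌉) (fun l => ⌊(x l + r) / h⌋)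

lemma mem_latticeCube {x : Fin d → ℝ} {r h : ℝ} (hh : 0 < h) {j : Fin d → ℤ} :
    j ∈ latticeCube x r h ↔ ∀ l, |h * j l - x l| ≤ r := by
  rw [latticeCube, Finset.mem_Icc, Pi.le_def, Pi.le_def, ← forall_and]
  refine forall_congr' fun l => ?_
  rw [Int.ceil_le, Int.le_floor, div_le_iff₀ hh, le_div_iff₀ hh, abs_le]
  constructor
  · rintro ⟨h1, h2⟩
    constructor <;> linarith
  · rintro ⟨h1, h2⟩
    constructor <;> linarith

lemma pow_le_card_latticeCube (x : Fin d → ℝ) {r h : ℝ} (hh : 0 < h) (hr : h ≤ r) :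
    (r / h) ^ d ≤ (latticeCube x r h).card := by
  rw [latticeCube, Pi.card_Icc, Nat.cast_prod]
  calc (r / h) ^ d = ∏ _l : Fin d, r / h := by simp [div_pow]
    _ ≤ _ := by
      refine Finset.prod_le_prod (fun l _ => div_nonneg (hh.le.trans hr) hh.le) fun l _ => ?_
      rw [Int.card_Icc]
      have h1 : ((⌊(x l + r) / h⌋ + 1 - ⌈(x l - r) / h⌉ : ℤ) : ℝ)
          ≤ ((⌊(x l + r) / h⌋ + 1 - ⌈(x l - r) / h⌉).toNat : ℝ) := by
        exact_mod_cast Int.self_le_toNat _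
      refine le_trans ?_ h1
      push_cast
      have h2 := Int.lt_floor_add_one ((x l + r) / h)
      have h3 := Int.ceil_lt_add_one ((x l - r) / h)
      have h4 : 1 ≤ r / h := by rwa [one_le_div hh]
      have h5 : (x l + r) / h - (x l - r) / h = 2 * (r / h) := by ring
      linarith

/-- A cuboid of lattice points that contains every `j` for which `j - k` belongs to the cube of
half-side `r / h` around the origin, for some `k` in the box with lowest corner `a` and sides
`m`. -/
noncomputable def fatCube (a : Fin d → ℤ) (m : Fin d → ℕ) (r h : ℝ) : Finset (Fin d → ℤ) :=
  Finset.Icc (fun l => ⌈-r / h⌉ + a l) (fun l => ⌊r / h⌋ + (a l + m l - 1))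

lemma card_fatCube_le (a : Fin d → ℤ) (m : Fin d → ℕ) {r h : ℝ} (hh : 0 < h) (hr : 0 ≤ r)
    (hm : ∀ l, m l * h ≤ 1) :
    ((fatCube a m r h).card : ℝ) ≤ ((2 * r + 1) / h) ^ d := by
  rw [fatCube, Pi.card_Icc, Nat.cast_prod]
  calc _ ≤ ∏ _l : Fin d, (2 * r + 1) / h := by
        refine Finset.prod_le_prod (fun l _ => Nat.cast_nonneg _) fun l _ => ?_
        rw [Int.card_Icc]
        have h1 : (((⌊r / h⌋ + (a l + m l - 1) + 1 - (⌈-r / h⌉ + a l)).toNat : ℤ) : ℝ)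
            ≤ (2 * r + 1) / h := by
          rw [Int.toNat_of_nonneg]
          · push_cast
            have h2 := Int.floor_le (r / h)
            have h3 := Int.le_ceil (-r / h)
            have h4 : (m l : ℝ) ≤ 1 / h := by rw [le_div_iff₀ hh]; exact hm l
            have h5 : (2 * r + 1) / h = r / h - (-r / h) + 1 / h := by ring
            linarith
          · have h2 : 0 ≤ ⌊r / h⌋ := Int.floor_nonneg.2 (by positivity)
            have h3 : ⌈-r / h⌉ ≤ 0 := Int.ceil_le.2 (by
              rw [neg_div]; push_cast; have : 0 ≤ r / h := by positivity
              linarith)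
            omega
        exact_mod_cast h1
    _ = _ := by simp [div_pow]

lemma mem_fatCube {a : Fin d → ℤ} {m : Fin d → ℕ} {r h : ℝ} {j k : Fin d → ℤ}
    (hk : k ∈ Finset.Icc a fun l => a l + m l - 1) (hj : j - k ∈ latticeCube 0 r h) :
    j ∈ fatCube a m r h := by
  rw [latticeCube, Finset.mem_Icc, Pi.le_def, Pi.le_def] at hj
  rw [Finset.mem_Icc, Pi.le_def, Pi.le_def] at hk
  rw [fatCube, Finset.mem_Icc, Pi.le_def, Pi.le_def]
  constructor
  · intro l
    have h1 := hj.1 l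
    have h2 := hk.1 l
    simp only [Pi.zero_apply, zero_sub, Pi.sub_apply] at h1
    omega
  · intro l
    have h1 := hj.2 l
    have h2 := hk.2 l
    simp only [Pi.zero_apply, zero_add, Pi.sub_apply] at h1
    omega

lemma latticeCube_zero_card_le {r h : ℝ} (hh : 0 < h) (hr : 0 ≤ r) (h1 : h ≤ 1) :
    ((latticeCube (0 : Fin d → ℝ) r h).card : ℝ) ≤ ((2 * r + 1) / h) ^ d := by
  refine le_trans ?_ (card_fatCube_le (0 : Fin d → ℤ) (fun _ => 1) hh hr (fun _ => by simpa using h1))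
  exact_mod_cast Finset.card_le_card fun j hj =>
    mem_fatCube (k := 0) (by simp [Pi.le_def]) (by simpa using hj)

/-! ### Lattice samples of the profile -/

/-- The samples `f(h j)` of the profile. -/
noncomputable def sample (f : EuclideanSpace ℝ (Fin d) → ℝ) (h : ℝ) (j : Fin d → ℤ) : ℝ :=
  f (WithLp.toLp 2 fun l => h * j l)

/-- The phase `∑_l j_l / m_l`, measured in full periods. -/
noncomputable def phase (m : Fin d → ℕ) (j : Fin d → ℤ) : ℝ := ∑ l, 1 / (m l : ℝ) * j l

/-- The modulated samples `f(h j) cos(2π ∑_l j_l / m_l)`. -/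
noncomputable def modSample (f : EuclideanSpace ℝ (Fin d) → ℝ) (m : Fin d → ℕ) (h : ℝ)
    (j : Fin d → ℤ) : ℝ :=
  sample f h j * Real.cos (2 * Real.pi * phase m j)

variable {f : EuclideanSpace ℝ (Fin d) → ℝ}

lemma IsProfile.sample_nonneg (hf : IsProfile f) (h : ℝ) (j : Fin d → ℤ) : 0 ≤ sample f h j :=
  hf.nonneg _

lemma IsProfile.exists_le (hf : IsProfile f) : ∃ F > 0, ∀ x, f x ≤ F := by
  obtain ⟨F, hF⟩ := hf.continuous.bounded_above_of_compact_support hf.hasCompactSupport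
  exact ⟨max F 1, by positivity, fun x =>
    (le_abs_self _).trans ((hF x).trans (le_max_left _ _))⟩

lemma IsProfile.exists_support_radius (hf : IsProfile f) :
    ∃ R > 0, ∀ h, 0 < h → ∀ j, j ∉ latticeCube 0 R h → sample f h j = 0 := by
  obtain ⟨R, hR⟩ := hf.hasCompactSupport.isCompact.isBounded.exists_norm_le
  refine ⟨max R 1, by positivity, fun h hh j hj => ?_⟩
  by_contra hne
  apply hj
  rw [mem_latticeCube hh]
  intro l
  have h1 := hR _ (subset_tsupport f hne)
  have h2 := PiLp.norm_apply_le (WithLp.toLp 2 fun l => h * (j l : ℝ) : EuclideanSpace ℝ (Fin d)) l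
  rw [Real.norm_eq_abs] at h2
  simp only [Pi.zero_apply, sub_zero]
  exact h2.trans (h1.trans (le_max_left _ _))

lemma IsProfile.exists_lower (hf : IsProfile f) :
    ∃ x : Fin d → ℝ, ∃ r > 0, ∃ ε > 0, ∀ h, 0 < h → ∀ j ∈ latticeCube x r h,
      ε ≤ sample f h j := by
  obtain ⟨y, hy⟩ : ∃ y, 0 < f y := by
    by_contra! hcon
    have h0 : f = 0 := funext fun y => le_antisymm (hcon y) (hf.nonneg y)
    have := hf.integral_eq_one
    rw [h0] at this
    simp at this
  have hcont : Continuous fun x : Fin d → ℝ => f (WithLp.toLp 2 x) :=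
    hf.continuous.comp (PiLp.continuous_toLp 2 _)
  have hy' : f y / 2 < f (WithLp.toLp 2 (WithLp.ofLp y)) := by
    rw [WithLp.toLp_ofLp]; linarith
  have hev := hcont.continuousAt.eventually (lt_mem_nhds hy')
  obtain ⟨r, hr, hball⟩ := Metric.nhds_basis_closedBall.eventually_iff.1 hev
  refine ⟨WithLp.ofLp y, r, hr, f y / 2, by positivity, fun h hh j hj => ?_⟩
  rw [mem_latticeCube hh] at hj
  refine (hball ?_).le
  rw [Metric.mem_closedBall, dist_pi_le_iff hr.le]
  exact hj

end Lattice

/-! ### The two blurs and their images -/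

section TwoBlurs

variable {f : EuclideanSpace ℝ (Fin d) → ℝ}

lemma tsum_eq_sum_latticeCube {R h : ℝ}
    {F : (Fin d → ℤ) → ℝ} (hF : ∀ j, j ∉ latticeCube 0 R h → F j = 0) :
    ∑' j, F j = ∑ j ∈ latticeCube 0 R h, F j :=
  tsum_eq_sum fun j hj => hF j hj

lemma windowSum_eq (f : EuclideanSpace ℝ (Fin d) → ℝ) (a : Fin d → ℤ) (m : Fin d → ℕ) (h : ℝ)
    (j : Fin d → ℤ) :
    windowSum (coordProfile f) a m h j = ∑ k ∈ Finset.Icc a (fun l => a l + m l - 1),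
      (sample f h (j - k) : ℂ) * unitExp (phase m (j - k)) := by
  refine Finset.sum_congr rfl fun k _ => ?_
  simp [coordProfile, sample, phase]

lemma re_windowSum (f : EuclideanSpace ℝ (Fin d) → ℝ) (a : Fin d → ℤ) (m : Fin d → ℕ) (h : ℝ)
    (j : Fin d → ℤ) :
    (windowSum (coordProfile f) a m h j).re
      = ∑ k ∈ Finset.Icc a (fun l => a l + m l - 1), modSample f m h (j - k) := by
  rw [windowSum_eq, Complex.re_sum]
  refine Finset.sum_congr rfl fun k _ => ?_
  rw [Complex.re_ofReal_mul, re_unitExp, modSample]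

lemma card_box (a : Fin d → ℤ) (m : Fin d → ℕ) :
    (Finset.Icc a (fun l => a l + m l - 1)).card = ∏ l, m l := by
  rw [Pi.card_Icc]
  exact Finset.prod_congr rfl fun l _ => card_Icc_add_sub_one _ _

/-- Summing a window sum over all lattice points multiplies the total by the volume of the box. -/
lemma sum_fatCube_sum_box {E : Type*} [AddCommMonoid E] {F : (Fin d → ℤ) → E} {R h : ℝ}
    (hF : ∀ j, j ∉ latticeCube 0 R h → F j = 0) (a : Fin d → ℤ) (m : Fin d → ℕ) :
    ∑ j ∈ fatCube a m R h, ∑ k ∈ Finset.Icc a (fun l => a l + m l - 1), F (j - k)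
      = (∏ l, m l) • ∑ j ∈ latticeCube 0 R h, F j := by
  rw [Finset.sum_comm, ← card_box a m, ← Finset.sum_const]
  refine Finset.sum_congr rfl fun k hk => ?_
  symm
  refine Eq.trans ?_ (Finset.sum_map (fatCube a m R h) (Equiv.subRight k).toEmbedding F)
  refine Finset.sum_subset (fun j hj => ?_) fun j _ hj => hF j hj
  rw [Finset.mem_map_equiv]
  refine mem_fatCube hk ?_
  simpa using hj

/-- The total of the modulated samples is negligible: it is the box average of a window sum, and
the window sums are small in mean square. -/
lemma exists_abs_sum_modSample_le {p : ℝ} (hd : 1 ≤ d)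
    (hf : IsProfile f) (hfp : FtDecay f p) (hp : 3 / 2 * (d : ℝ) < p) {R : ℝ} (hR : 0 < R)
    (hsupp : ∀ h, 0 < h → ∀ j, j ∉ latticeCube 0 R h → sample f h j = 0) :
    ∃ C > 0, ∀ (m : Fin d → ℕ), (∀ l, 2 ≤ m l) → ∀ h : ℝ, 0 < h → (∀ l, m l * h ≤ 1) →
      |∑ j ∈ latticeCube 0 R h, modSample f m h j| ≤ C * ∏ l, (m l : ℝ) := by
  obtain ⟨C, hC0, hC⟩ := exists_sum_norm_windowSum_sq_le hd hf hfp hp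
  set C' := (2 * R + 1) ^ d * C with hC'
  have hC'0 : 0 < C' := by positivity
  refine ⟨Real.sqrt C', Real.sqrt_pos.2 hC'0, fun m hm h hh hmh => ?_⟩
  set w : (Fin d → ℤ) → ℂ := fun j => (sample f h j : ℂ) * unitExp (phase m j) with hw
  have hw0 : ∀ j, j ∉ latticeCube 0 R h → w j = 0 := fun j hj => by
    simp [hw, hsupp h hh j hj]
  set Z := ∑ j ∈ latticeCube 0 R h, w j with hZ
  have hre : ∑ j ∈ latticeCube 0 R h, modSample f m h j = Z.re := by
    rw [hZ, Complex.re_sum]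
    refine Finset.sum_congr rfl fun j _ => ?_
    rw [hw, Complex.re_ofReal_mul, re_unitExp, modSample]
  have hsum : ∑ j ∈ fatCube 0 m R h, windowSum (coordProfile f) 0 m h j = (∏ l, m l) • Z := by
    simp_rw [windowSum_eq]
    exact sum_fatCube_sum_box hw0 0 m
  set V : ℝ := ∏ l, (m l : ℝ) with hV
  have hV0 : 0 < V := Finset.prod_pos fun l _ => by
    have := hm l
    exact_mod_cast (by omega : 0 < m l)
  have hnorm : V * ‖Z‖ ≤ ∑ j ∈ fatCube 0 m R h, ‖windowSum (coordProfile f) 0 m h j‖ := by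
    refine le_trans (le_of_eq ?_) (norm_sum_le _ _)
    rw [hsum, nsmul_eq_mul, norm_mul, Complex.norm_natCast, hV]
    push_cast
    rfl
  have hV4 : ∏ l, (m l : ℝ) ^ 4 = V ^ 4 := by rw [hV, Finset.prod_pow]
  have hcs := sq_sum_le_card_mul_sum_sq (s := fatCube 0 m R h)
    (f := fun j => ‖windowSum (coordProfile f) 0 m h j‖)
  have h1 : (V * ‖Z‖) ^ 2 ≤ ((2 * R + 1) / h) ^ d * (C * V ^ 4 * h ^ d) := by
    calc (V * ‖Z‖) ^ 2 ≤ (∑ j ∈ fatCube 0 m R h, ‖windowSum (coordProfile f) 0 m h j‖) ^ 2 := by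
          gcongr
      _ ≤ _ := hcs
      _ ≤ _ := by
          rw [← hV4]
          gcongr
          · exact card_fatCube_le 0 m hh hR.le hmh
          · exact hC 0 m hm h hh _
  have h2 : (V * ‖Z‖) ^ 2 ≤ C' * V ^ 4 := by
    refine h1.trans (le_of_eq ?_)
    rw [hC', div_pow]
    field_simp
  have h3 : ‖Z‖ ^ 2 ≤ C' * V ^ 2 := by
    have : V ^ 2 * ‖Z‖ ^ 2 ≤ V ^ 2 * (C' * V ^ 2) := by nlinarith
    exact le_of_mul_le_mul_left this (by positivity)
  rw [hre]
  refine (Complex.abs_re_le_norm Z).trans ?_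
  rw [← Real.sqrt_sq hV0.le, ← Real.sqrt_mul hC'0.le]
  exact Real.le_sqrt_of_sq_le h3

lemma cos_sq_add_cos_sq_ge {x y : ℝ} (hy : |Real.cos y| ≤ 1 / 2) :
    1 / 2 ≤ Real.cos x ^ 2 + Real.cos (x + y) ^ 2 := by
  have h1 : Real.cos x ^ 2 + Real.cos (x + y) ^ 2 = 1 + Real.cos (2 * x + y) * Real.cos y := by
    rw [Real.cos_sq, Real.cos_sq, show 2 * (x + y) = (2 * x + y) + y by ring, Real.cos_add,
      show Real.cos (2 * x) = Real.cos ((2 * x + y) - y) by ring_nf, Real.cos_sub]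
    ring
  have h2 : |Real.cos (2 * x + y) * Real.cos y| ≤ 1 / 2 := by
    rw [abs_mul]
    calc _ ≤ 1 * (1 / 2 : ℝ) := by
          gcongr
          exact Real.abs_cos_le_one _
      _ = _ := by norm_num
  rw [h1]
  linarith [(abs_le.1 h2).1]

/-- A quarter-period, rounded down, still turns the phase by an angle between `60°` and `90°`. -/
lemma abs_cos_quarter_le {m : ℕ} (hm : 12 ≤ m) :
    |Real.cos (2 * Real.pi * (1 / (m : ℝ) * (m / 4 : ℕ)))| ≤ 1 / 2 := by
  have hm0 : (0 : ℝ) < m := by exact_mod_cast (by omega : 0 < m)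
  have h1 : 4 * ((m / 4 : ℕ) : ℝ) ≤ m := by exact_mod_cast Nat.mul_div_le m 4
  have h2 : (m : ℝ) ≤ 6 * ((m / 4 : ℕ) : ℝ) := by exact_mod_cast (by omega : m ≤ 6 * (m / 4))
  set q : ℝ := ((m / 4 : ℕ) : ℝ)
  have h3 : 1 / (m : ℝ) * q ≤ 1 / 4 := by
    rw [one_div, ← div_eq_inv_mul, div_le_iff₀ hm0]; linarith
  have h4 : 1 / 6 ≤ 1 / (m : ℝ) * q := by
    rw [one_div (m : ℝ), ← div_eq_inv_mul, le_div_iff₀ hm0]; linarith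
  have hpi := Real.pi_pos
  have h5 : Real.cos (2 * Real.pi * (1 / (m : ℝ) * q)) ≤ Real.cos (Real.pi / 3) :=
    Real.cos_le_cos_of_nonneg_of_le_pi (by positivity) (by nlinarith) (by nlinarith)
  have h6 : 0 ≤ Real.cos (2 * Real.pi * (1 / (m : ℝ) * q)) :=
    Real.cos_nonneg_of_neg_pi_div_two_le_of_le (by nlinarith) (by nlinarith)
  rw [Real.cos_pi_div_three] at h5
  rwa [abs_of_nonneg h6]

/-- The modulated samples keep a fixed proportion of the energy: shifting by a quarter-period in
one coordinate turns a small cosine into a large one. -/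
lemma sum_sq_modSample_ge (hd : 1 ≤ d) {x : Fin d → ℝ} {r ε : ℝ} (hε : 0 < ε)
    (hlow : ∀ h, 0 < h → ∀ j ∈ latticeCube x r h, ε ≤ sample f h j)
    {m : Fin d → ℕ} (hm : ∀ l, 12 ≤ m l) {h : ℝ} (hh : 0 < h) (hmh : ∀ l, m l * h ≤ r / 2) :
    ε ^ 2 / 4 * (r / 2 / h) ^ d ≤ ∑ j ∈ latticeCube x r h, modSample f m h j ^ 2 := by
  set i : Fin d := ⟨0, by omega⟩
  set q : Fin d → ℤ := Pi.single i ((m i / 4 : ℕ) : ℤ) with hq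
  have hm1 : (1 : ℝ) ≤ m i := by have := hm i; exact_mod_cast (by omega : 1 ≤ m i)
  have hhr : h ≤ r / 2 := by have := hmh i; nlinarith
  have hr0 : 0 < r := by linarith
  have hphase : ∀ j, phase m (j + q) = phase m j + 1 / (m i : ℝ) * (m i / 4 : ℕ) := by
    intro j
    simp only [phase, Pi.add_apply, Int.cast_add, mul_add, Finset.sum_add_distrib]
    congr 1
    rw [Finset.sum_eq_single i]
    · rw [hq, Pi.single_eq_same, Int.cast_natCast]
    · intro l _ hl
      simp [hq, Pi.single_eq_of_ne hl]
    · simp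
  have hsq : ∀ j ∈ latticeCube x r h,
      ε ^ 2 * Real.cos (2 * Real.pi * phase m j) ^ 2 ≤ modSample f m h j ^ 2 := by
    intro j hj
    rw [modSample, mul_pow]
    gcongr
    exact hlow h hh j hj
  have hsub1 : latticeCube x (r / 2) h ⊆ latticeCube x r h := by
    intro j hj
    rw [mem_latticeCube hh] at hj ⊢
    exact fun l => (hj l).trans (by linarith)
  have hsub2 : (latticeCube x (r / 2) h).map (Equiv.addRight q).toEmbedding
      ⊆ latticeCube x r h := by
    intro j hj
    rw [Finset.mem_map] at hj
    obtain ⟨k, hk, rfl⟩ := hj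
    rw [mem_latticeCube hh] at hk ⊢
    intro l
    have h1 := hk l
    have h2 : |h * (q l : ℝ)| ≤ r / 2 := by
      by_cases hl : l = i
      · subst hl
        simp only [hq, Pi.single_eq_same]
        rw [abs_of_nonneg (by positivity)]
        refine le_trans ?_ (hmh i)
        rw [mul_comm]
        gcongr
        exact_mod_cast Nat.div_le_self _ _
      · rw [hq, Pi.single_eq_of_ne hl]
        simp only [Int.cast_zero, mul_zero, abs_zero]
        positivity
    simp only [Equiv.coe_toEmbedding, Equiv.coe_addRight, Pi.add_apply, Int.cast_add]
    calc |h * ((k l : ℝ) + q l) - x l| = |(h * k l - x l) + h * q l| := by ring_nf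
      _ ≤ |h * k l - x l| + |h * q l| := abs_add_le _ _
      _ ≤ r := by linarith
  have hs1 : ∑ j ∈ latticeCube x (r / 2) h, modSample f m h j ^ 2
      ≤ ∑ j ∈ latticeCube x r h, modSample f m h j ^ 2 :=
    Finset.sum_le_sum_of_subset_of_nonneg hsub1 fun _ _ _ => sq_nonneg _
  have hs2 : ∑ j ∈ latticeCube x (r / 2) h, modSample f m h (j + q) ^ 2
      ≤ ∑ j ∈ latticeCube x r h, modSample f m h j ^ 2 := by
    refine le_trans (le_of_eq ?_)
      (Finset.sum_le_sum_of_subset_of_nonneg hsub2 fun _ _ _ => sq_nonneg _)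
    rw [Finset.sum_map]
    rfl
  have hpair : ∀ j ∈ latticeCube x (r / 2) h,
      ε ^ 2 / 2 ≤ modSample f m h j ^ 2 + modSample f m h (j + q) ^ 2 := by
    intro j hj
    have h1 := hsq j (hsub1 hj)
    have h2 := hsq (j + q) (hsub2 (Finset.mem_map_of_mem _ hj))
    have h3 := cos_sq_add_cos_sq_ge (x := 2 * Real.pi * phase m j) (abs_cos_quarter_le (hm i))
    rw [hphase, mul_add] at h2
    have h4 := mul_le_mul_of_nonneg_left h3 (sq_nonneg ε)
    linarith
  have hcard := pow_le_card_latticeCube x hh hhr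
  have h5 : (latticeCube x (r / 2) h).card * (ε ^ 2 / 2)
      ≤ ∑ j ∈ latticeCube x (r / 2) h, (modSample f m h j ^ 2 + modSample f m h (j + q) ^ 2) := by
    rw [← nsmul_eq_mul]
    exact Finset.card_nsmul_le_sum _ _ _ hpair
  rw [Finset.sum_add_distrib] at h5
  have h6 : (r / 2 / h) ^ d * (ε ^ 2 / 2) ≤ (latticeCube x (r / 2) h).card * (ε ^ 2 / 2) := by
    gcongr
  linarith

lemma blurred_testSignal (φ : (Fin d → ℤ) → ℝ) (a b j : Fin d → ℤ) :
    blurred φ (testSignal a b) j = ∑ k ∈ Finset.Icc a b, φ (j - k) := by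
  rw [blurred, tsum_eq_sum (s := Finset.Icc a b)]
  · refine Finset.sum_congr rfl fun k hk => ?_
    rw [testSignal, Set.indicator_of_mem (by simpa using hk)]
    simp
  · intro k hk
    rw [testSignal, Set.indicator_of_notMem (by simpa using hk), mul_zero]

/-- The blur proportional to the samples of the profile. -/
noncomputable def plainBlur (f : EuclideanSpace ℝ (Fin d) → ℝ) (h : ℝ) (j : Fin d → ℤ) : ℝ :=
  sample f h j / ∑' i, sample f h i

/-- The blur proportional to the samples of the profile times `1 + cos`. -/
noncomputable def wavyBlur (f : EuclideanSpace ℝ (Fin d) → ℝ) (m : Fin d → ℕ) (h : ℝ)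
    (j : Fin d → ℤ) : ℝ :=
  (sample f h j + modSample f m h j) / ∑' i, (sample f h i + modSample f m h i)

/-- The image of a test box under the difference of the two blurs. -/
noncomputable def imageDiff (f : EuclideanSpace ℝ (Fin d) → ℝ) (a : Fin d → ℤ) (m : Fin d → ℕ)
    (h : ℝ) (j : Fin d → ℤ) : ℝ :=
  ∑ k ∈ Finset.Icc a (fun l => a l + m l - 1), (wavyBlur f m h (j - k) - plainBlur f h (j - k))

lemma sub_sq_le (x y : ℝ) : (x - y) ^ 2 ≤ 2 * x ^ 2 + 2 * y ^ 2 := by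
  nlinarith [sq_nonneg (x + y)]

lemma half_sq_sub_sq_le (x y : ℝ) : x ^ 2 / 2 - y ^ 2 ≤ (x - y) ^ 2 := by
  nlinarith [sq_nonneg (x - 2 * y)]

set_option maxHeartbeats 1000000 in
/-- The two blurs are far apart in mean square, whereas their images of the test box are close. -/
theorem exists_blur_bounds {p : ℝ} (hd : 1 ≤ d) (hf : IsProfile f) (hfp : FtDecay f p)
    (hp : 3 / 2 * (d : ℝ) < p) :
    ∃ κ > 0, ∃ C > 0, ∃ c > 0, ∀ (a : Fin d → ℤ) (m : Fin d → ℕ) (h : ℝ), 0 < h →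
      (∀ l, 12 ≤ m l) → (∀ l, m l * h ≤ κ) →
        0 < ∑' j, sample f h j ∧ 0 < ∑' j, (sample f h j + modSample f m h j) ∧
        (∃ J : Finset (Fin d → ℤ), (∀ j ∉ J, imageDiff f a m h j = 0) ∧
          ∑ j ∈ J, imageDiff f a m h j ^ 2 ≤ C * (∏ l, (m l : ℝ)) ^ 4 * h ^ (3 * d)) ∧
        ∃ J : Finset (Fin d → ℤ),
          c * h ^ d ≤ ∑ j ∈ J, (wavyBlur f m h j - plainBlur f h j) ^ 2 := by
  obtain ⟨R, hR, hsupp⟩ := hf.exists_support_radius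
  obtain ⟨F, hF, hFle⟩ := hf.exists_le
  obtain ⟨x, r, hr, ε, hε, hlow⟩ := hf.exists_lower
  obtain ⟨C₁, hC₁, hV⟩ := exists_abs_sum_modSample_le hd hf hfp hp hR hsupp
  obtain ⟨C₃, hC₃, hW⟩ := exists_sum_norm_windowSum_sq_le hd hf hfp hp
  set c₀ := ε * r ^ d with hc₀
  set C₄ := (2 * R + 1) ^ d with hC₄
  set c₅ := ε ^ 2 / 4 * (r / 2) ^ d with hc₅
  have hc₀0 : 0 < c₀ := by positivity
  have hC₄0 : 0 < C₄ := by positivity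
  have hc₅0 : 0 < c₅ := by positivity
  set B := 4 * F ^ 2 * C₄ * C₁ ^ 2 / c₀ ^ 4 with hB
  set c := c₅ / (16 * (F * C₄) ^ 2) with hc
  have hB0 : 0 < B := by positivity
  have hc0 : 0 < c := by positivity
  -- `c₀ / (2 * C₁)` keeps the total of the modulated samples below half that of the samples, and
  -- `c / B` makes the effect of the different norming constants small against the modulation
  refine ⟨min (min 1 (r / 2)) (min (c₀ / (2 * C₁)) (c / B)), by positivity,
    8 * C₃ / c₀ ^ 2 + 8 * C₁ ^ 2 * F ^ 2 * C₄ / c₀ ^ 4, by positivity, c, hc0,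
    fun a m h hh hm hmκ => ?_⟩
  set κ := min (min 1 (r / 2)) (min (c₀ / (2 * C₁)) (c / B)) with hκ
  have hκ1 : κ ≤ 1 := (min_le_left _ _).trans (min_le_left _ _)
  have hκr : κ ≤ r / 2 := (min_le_left _ _).trans (min_le_right _ _)
  have hκ2 : κ * (2 * C₁) ≤ c₀ := by
    rw [← le_div_iff₀ (by positivity)]
    exact (min_le_right _ _).trans (min_le_left _ _)
  have hκ3 : κ * B ≤ c := by
    rw [← le_div_iff₀ hB0]
    exact (min_le_right _ _).trans (min_le_right _ _)
  have hκ0 : 0 ≤ κ := by positivity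
  have hm2 : ∀ l, 2 ≤ m l := fun l => le_trans (by norm_num) (hm l)
  have hmh1 : ∀ l, m l * h ≤ 1 := fun l => (hmκ l).trans hκ1
  have hhκ : h ≤ κ := by
    have h1 := hmκ ⟨0, by omega⟩
    have h2 : (12 : ℝ) ≤ m ⟨0, by omega⟩ := by exact_mod_cast hm ⟨0, by omega⟩
    nlinarith
  set H := h ^ d with hH
  have hH0 : 0 < H := by positivity
  set N := ∏ l, (m l : ℝ) with hN
  have hN0 : 0 < N := Finset.prod_pos fun l _ => by
    have := hm l
    exact_mod_cast (by omega : 0 < m l)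
  have hNH : N * H ≤ κ := by
    have h1 : N * H = ∏ l, ((m l : ℝ) * h) := by
      rw [Finset.prod_mul_distrib, Finset.prod_const, Finset.card_univ, Fintype.card_fin]
    rw [h1]
    calc ∏ l, ((m l : ℝ) * h) ≤ ∏ _l : Fin d, κ :=
          Finset.prod_le_prod (fun l _ => by positivity) fun l _ => hmκ l
      _ = κ ^ d := by simp
      _ ≤ κ := pow_le_of_le_one hκ0 hκ1 (by omega)
  set L := latticeCube (0 : Fin d → ℝ) R h with hL
  have hs0 : ∀ j, j ∉ L → sample f h j = 0 := hsupp h hh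
  have hv0 : ∀ j, j ∉ L → modSample f m h j = 0 := fun j hj => by
    rw [modSample, hs0 j hj, zero_mul]
  have hsnn : ∀ j, 0 ≤ sample f h j := hf.sample_nonneg h
  have hsF : ∀ j, sample f h j ≤ F := fun j => hFle _
  have hUeq : ∑' j, sample f h j = ∑ j ∈ L, sample f h j := tsum_eq_sum_latticeCube hs0
  have hSeq : ∑' j, (sample f h j + modSample f m h j)
      = ∑ j ∈ L, sample f h j + ∑ j ∈ L, modSample f m h j := by
    rw [← Finset.sum_add_distrib]
    exact tsum_eq_sum_latticeCube fun j hj => by rw [hs0 j hj, hv0 j hj, add_zero]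
  set U := ∑ j ∈ L, sample f h j with hU
  set V := ∑ j ∈ L, modSample f m h j with hVdef
  set S := U + V with hS
  have hsub : latticeCube x r h ⊆ L := by
    intro j hj
    by_contra hcon
    have h1 := hlow h hh j hj
    rw [hs0 j hcon] at h1
    linarith
  have hcardL : (L.card : ℝ) ≤ C₄ / H := by
    have h1 := latticeCube_zero_card_le (d := d) hh hR.le (hhκ.trans hκ1)
    rwa [div_pow] at h1
  have hUlow : c₀ / H ≤ U := by
    have h1 : (latticeCube x r h).card * ε ≤ ∑ j ∈ latticeCube x r h, sample f h j := by
      rw [← nsmul_eq_mul]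
      exact Finset.card_nsmul_le_sum _ _ _ (hlow h hh)
    have h2 : ∑ j ∈ latticeCube x r h, sample f h j ≤ U :=
      Finset.sum_le_sum_of_subset_of_nonneg hsub fun j _ _ => hsnn j
    have h3 := pow_le_card_latticeCube x hh (show h ≤ r by linarith)
    rw [div_pow] at h3
    calc c₀ / H = r ^ d / h ^ d * ε := by rw [hc₀, hH]; ring
      _ ≤ _ := (mul_le_mul_of_nonneg_right h3 hε.le).trans (h1.trans h2)
  have hUup : U ≤ F * C₄ / H := by
    calc U ≤ L.card • F := Finset.sum_le_card_nsmul _ _ _ fun j _ => hsF j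
      _ = L.card * F := nsmul_eq_mul _ _
      _ ≤ C₄ / H * F := by gcongr
      _ = _ := by ring
  have hU0 : 0 < U := lt_of_lt_of_le (by positivity) hUlow
  have hVabs : |V| ≤ C₁ * N := hV m hm2 h hh hmh1
  have hVU : |V| ≤ c₀ / (2 * H) := by
    refine hVabs.trans ?_
    rw [le_div_iff₀ (by positivity)]
    nlinarith
  have hSlow : c₀ / (2 * H) ≤ S := by
    have h1 := (abs_le.1 hVU).1
    have h2 : c₀ / H = c₀ / (2 * H) + c₀ / (2 * H) := by field_simp; ring
    linarith
  have hS0 : 0 < S := lt_of_lt_of_le (by positivity) hSlow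
  have hSup : S ≤ 2 * (F * C₄ / H) := by
    have h1 : |V| ≤ U := hVU.trans (le_trans (by
      rw [div_le_div_iff₀ (by positivity) hH0]; nlinarith [mul_pos hc₀0 hH0]) hUlow)
    have := le_abs_self V
    linarith
  rw [hUeq, hSeq]
  refine ⟨hU0, hS0, ?_, ?_⟩
  -- the inverse norming constants are of order `h^d`
  all_goals
    have hSinv : S⁻¹ ≤ 2 * H / c₀ := by
      rw [inv_le_comm₀ hS0 (by positivity), inv_div]; exact hSlow
    have hUinv : U⁻¹ ≤ H / c₀ := by
      rw [inv_le_comm₀ hU0 (by positivity), inv_div]; exact hUlow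
    have hdiff : ∀ j, wavyBlur f m h j - plainBlur f h j
        = S⁻¹ * modSample f m h j - V * U⁻¹ * S⁻¹ * sample f h j := by
      intro j
      rw [wavyBlur, plainBlur, hUeq, hSeq]
      field_simp
      rw [hS]
      ring
    have hcoef : (V * U⁻¹ * S⁻¹) ^ 2 ≤ C₁ ^ 2 * N ^ 2 * (4 * H ^ 4 / c₀ ^ 4) := by
      have h1 : |V * U⁻¹ * S⁻¹| ≤ C₁ * N * (H / c₀) * (2 * H / c₀) := by
        rw [abs_mul, abs_mul, abs_of_pos (inv_pos.2 hU0), abs_of_pos (inv_pos.2 hS0)]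
        gcongr
      rw [← sq_abs]
      calc |V * U⁻¹ * S⁻¹| ^ 2 ≤ (C₁ * N * (H / c₀) * (2 * H / c₀)) ^ 2 := by gcongr
        _ = _ := by field_simp; ring
  · refine ⟨fatCube a m R h, fun j hj => Finset.sum_eq_zero fun k hk => ?_, ?_⟩
    · have : j - k ∉ L := fun hcon => hj (mem_fatCube hk hcon)
      rw [hdiff, hs0 _ this, hv0 _ this, mul_zero, mul_zero, sub_zero]
    · have hη : ∀ j, imageDiff f a m h j ^ 2
          ≤ 2 * (2 * H / c₀) ^ 2 * ‖windowSum (coordProfile f) a m h j‖ ^ 2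
            + 2 * (C₁ ^ 2 * N ^ 2 * (4 * H ^ 4 / c₀ ^ 4)) * (F * N) ^ 2 := by
        intro j
        have h1 : imageDiff f a m h j = S⁻¹ * (windowSum (coordProfile f) a m h j).re
            - V * U⁻¹ * S⁻¹ * ∑ k ∈ Finset.Icc a (fun l => a l + m l - 1),
              sample f h (j - k) := by
          rw [re_windowSum, Finset.mul_sum, Finset.mul_sum, ← Finset.sum_sub_distrib]
          exact Finset.sum_congr rfl fun k _ => hdiff _
        have h2 : 0 ≤ ∑ k ∈ Finset.Icc a (fun l => a l + m l - 1), sample f h (j - k) :=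
          Finset.sum_nonneg fun k _ => hsnn _
        have h3 : ∑ k ∈ Finset.Icc a (fun l => a l + m l - 1), sample f h (j - k) ≤ F * N := by
          refine (Finset.sum_le_card_nsmul _ _ F fun k _ => hsF _).trans (le_of_eq ?_)
          rw [card_box, nsmul_eq_mul, hN, mul_comm]
          push_cast
          rfl
        have h4 := Complex.abs_re_le_norm (windowSum (coordProfile f) a m h j)
        rw [h1]
        set D := (windowSum (coordProfile f) a m h j).re
        set T := ∑ k ∈ Finset.Icc a (fun l => a l + m l - 1), sample f h (j - k)
        have h5 : (S⁻¹ * D - V * U⁻¹ * S⁻¹ * T) ^ 2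
            ≤ 2 * (S⁻¹) ^ 2 * |D| ^ 2 + 2 * (V * U⁻¹ * S⁻¹) ^ 2 * T ^ 2 := by
          have h6 := sub_sq_le (S⁻¹ * D) (V * U⁻¹ * S⁻¹ * T)
          rw [mul_pow, mul_pow (V * U⁻¹ * S⁻¹)] at h6
          rw [sq_abs]
          linarith only [h6]
        refine h5.trans ?_
        gcongr
      have hN4 : ∏ l, (m l : ℝ) ^ 4 = N ^ 4 := by rw [hN, Finset.prod_pow]
      calc ∑ j ∈ fatCube a m R h, imageDiff f a m h j ^ 2
          ≤ ∑ j ∈ fatCube a m R h,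
              (2 * (2 * H / c₀) ^ 2 * ‖windowSum (coordProfile f) a m h j‖ ^ 2
              + 2 * (C₁ ^ 2 * N ^ 2 * (4 * H ^ 4 / c₀ ^ 4)) * (F * N) ^ 2) :=
            Finset.sum_le_sum fun j _ => hη j
        _ = 2 * (2 * H / c₀) ^ 2 *
              ∑ j ∈ fatCube a m R h, ‖windowSum (coordProfile f) a m h j‖ ^ 2
            + (fatCube a m R h).card *
              (2 * (C₁ ^ 2 * N ^ 2 * (4 * H ^ 4 / c₀ ^ 4)) * (F * N) ^ 2) := by
            rw [Finset.sum_add_distrib, ← Finset.mul_sum, Finset.sum_const, nsmul_eq_mul]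
        _ ≤ 2 * (2 * H / c₀) ^ 2 * (C₃ * N ^ 4 * H)
            + C₄ / H * (2 * (C₁ ^ 2 * N ^ 2 * (4 * H ^ 4 / c₀ ^ 4)) * (F * N) ^ 2) := by
            have h1 := hW a m hm2 h hh (fatCube a m R h)
            rw [hN4] at h1
            have h2 := card_fatCube_le a m hh hR.le hmh1
            rw [div_pow] at h2
            gcongr
        _ = _ := by
            rw [show h ^ (3 * d) = H ^ 3 by rw [hH, ← pow_mul, mul_comm]]
            field_simp
            ring
  · refine ⟨L, ?_⟩
    have hlowsq : ∀ j, (S⁻¹) ^ 2 / 2 * modSample f m h j ^ 2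
        - C₁ ^ 2 * N ^ 2 * (4 * H ^ 4 / c₀ ^ 4) * F ^ 2
          ≤ (wavyBlur f m h j - plainBlur f h j) ^ 2 := by
      intro j
      rw [hdiff]
      have h1 : (V * U⁻¹ * S⁻¹) ^ 2 * sample f h j ^ 2
          ≤ C₁ ^ 2 * N ^ 2 * (4 * H ^ 4 / c₀ ^ 4) * F ^ 2 := by
        have := hsnn j
        have := hsF j
        gcongr
      have h2 := half_sq_sub_sq_le (S⁻¹ * modSample f m h j) (V * U⁻¹ * S⁻¹ * sample f h j)
      rw [mul_pow, mul_pow (V * U⁻¹ * S⁻¹)] at h2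
      linarith only [h1, h2]
    have hsum := Finset.sum_le_sum fun j (_ : j ∈ L) => hlowsq j
    rw [Finset.sum_sub_distrib, ← Finset.mul_sum, Finset.sum_const, nsmul_eq_mul] at hsum
    refine le_trans ?_ hsum
    have h1 : c₅ / H ≤ ∑ j ∈ L, modSample f m h j ^ 2 := by
      have h2 := sum_sq_modSample_ge hd hε hlow hm hh fun l => (hmκ l).trans hκr
      rw [div_pow, ← mul_div_assoc] at h2
      exact h2.trans (Finset.sum_le_sum_of_subset_of_nonneg hsub fun _ _ _ => sq_nonneg _)
    have h2 : H / (2 * (F * C₄)) ≤ S⁻¹ := by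
      rw [le_inv_comm₀ (by positivity) hS0, inv_div]
      refine hSup.trans (le_of_eq ?_)
      ring
    have h3 : (H / (2 * (F * C₄))) ^ 2 / 2 * (c₅ / H)
        ≤ (S⁻¹) ^ 2 / 2 * ∑ j ∈ L, modSample f m h j ^ 2 := by gcongr
    have h4 : (L.card : ℝ) * (C₁ ^ 2 * N ^ 2 * (4 * H ^ 4 / c₀ ^ 4) * F ^ 2)
        ≤ C₄ / H * (C₁ ^ 2 * N ^ 2 * (4 * H ^ 4 / c₀ ^ 4) * F ^ 2) := by gcongr
    have h5 : C₄ / H * (C₁ ^ 2 * N ^ 2 * (4 * H ^ 4 / c₀ ^ 4) * F ^ 2)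
        = B * (N * H) ^ 2 * H := by
      rw [hB]; field_simp
    have h6 : (H / (2 * (F * C₄))) ^ 2 / 2 * (c₅ / H) = 2 * c * H := by
      rw [hc]; field_simp; norm_num
    have h7 : (N * H) ^ 2 ≤ κ :=
      (pow_le_of_le_one (by positivity) (hNH.trans hκ1) two_ne_zero).trans hNH
    have h8 : B * (N * H) ^ 2 * H ≤ c * H :=
      mul_le_mul_of_nonneg_right ((mul_le_mul_of_nonneg_left h7 hB0.le).trans
        ((mul_comm B κ).le.trans hκ3)) hH0.le
    rw [h6] at h3
    rw [h5] at h4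
    linarith only [h3, h4, h8]

end TwoBlurs

/-! ### The blurs of the theorem in terms of lattice samples -/

section Link

variable {f : EuclideanSpace ℝ (Fin d) → ℝ}

/-- The frequency vector `(2π / c_l)_l`, whose cosine runs through full periods along the edges of
the test box. -/
noncomputable def edgeFrequency (c : Fin d → ℝ) : EuclideanSpace ℝ (Fin d) :=
  WithLp.toLp 2 fun l => 2 * Real.pi / c l

lemma inner_edgeFrequency_gridPoint {n : ℕ} (hn : n ≠ 0) {a b : Fin d → ℤ} {m : Fin d → ℕ}
    (hab : ∀ l, b l - a l + 1 = m l) (j : Fin d → ℤ) :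
    (⟪edgeFrequency (edge a b n), gridPoint n j⟫ : ℝ) = 2 * Real.pi * phase m j := by
  have hn0 : (n : ℝ) ≠ 0 := by exact_mod_cast hn
  simp only [edgeFrequency, gridPoint, phase, PiLp.inner_apply, Finset.mul_sum]
  refine Finset.sum_congr rfl fun l _ => ?_
  simp only [edge, hab, RCLike.inner_apply, conj_trivial, Int.cast_natCast]
  field_simp

lemma smul_gridPoint (δ : ℝ) (n : ℕ) (j : Fin d → ℤ) :
    δ • gridPoint n j = WithLp.toLp 2 fun l => δ / n * (j l : ℝ) := by
  ext l
  simp only [gridPoint, PiLp.smul_apply, smul_eq_mul]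
  ring

lemma blur_eq_div {δ : ℝ} (hδ : 0 < δ) {n : ℕ} (hn : n ≠ 0) {a b : Fin d → ℤ} {m : Fin d → ℕ}
    (hab : ∀ l, b l - a l + 1 = m l) {θ : ℝ}
    (hc : c₁ f δ (edgeFrequency (edge a b n)) θ ≠ 0) (j : Fin d → ℤ) :
    blur f δ (edgeFrequency (edge a b n)) n θ j
      = (sample f (δ / n) j + θ * modSample f m (δ / n) j) /
        ∑' i, (sample f (δ / n) i + θ * modSample f m (δ / n) i) := by
  have hn0 : (n : ℝ) ≠ 0 := by exact_mod_cast hn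
  set K := ((n : ℝ) ^ d)⁻¹ * (c₁ f δ (edgeFrequency (edge a b n)) θ * δ ^ d) with hK
  have hK0 : K ≠ 0 := by positivity
  have hchi : ∀ i, ((n : ℝ) ^ d)⁻¹ * chi f δ (edgeFrequency (edge a b n)) θ (gridPoint n i)
      = K * (sample f (δ / n) i + θ * modSample f m (δ / n) i) := by
    intro i
    rw [chi, inner_edgeFrequency_gridPoint hn hab, smul_gridPoint, modSample, sample, hK]
    ring
  rw [blur, c₂, mul_assoc, hchi]
  simp_rw [hchi]
  rw [tsum_mul_left, mul_inv]
  field_simp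

lemma blur_zero_eq {δ : ℝ} (hδ : 0 < δ) {n : ℕ} (hn : n ≠ 0) {a b : Fin d → ℤ} {m : Fin d → ℕ}
    (hab : ∀ l, b l - a l + 1 = m l) :
    blur f δ (edgeFrequency (edge a b n)) n 0 = plainBlur f (δ / n) := by
  ext j
  rw [blur_eq_div hδ hn hab (by simp [c₁]), plainBlur]
  simp

lemma blur_one_eq {δ : ℝ} (hδ : 0 < δ) {n : ℕ} (hn : n ≠ 0) {a b : Fin d → ℤ} {m : Fin d → ℕ}
    (hab : ∀ l, b l - a l + 1 = m l)
    (hc : c₁ f δ (edgeFrequency (edge a b n)) 1 ≠ 0) :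
    blur f δ (edgeFrequency (edge a b n)) n 1 = wavyBlur f m (δ / n) := by
  ext j
  rw [blur_eq_div hδ hn hab hc, wavyBlur]
  simp

lemma tsum_plainBlur {h : ℝ} (hU : 0 < ∑' j, sample f h j) : ∑' j, plainBlur f h j = 1 := by
  simp only [plainBlur]
  rw [tsum_div_const, div_self hU.ne']

lemma tsum_wavyBlur {m : Fin d → ℕ} {h : ℝ}
    (hU : 0 < ∑' j, (sample f h j + modSample f m h j)) : ∑' j, wavyBlur f m h j = 1 := by
  simp only [wavyBlur]
  rw [tsum_div_const, div_self hU.ne']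

lemma blurred_sub_blurred_eq_imageDiff (f : EuclideanSpace ℝ (Fin d) → ℝ) {a b : Fin d → ℤ}
    {m : Fin d → ℕ} (hab : ∀ l, b l - a l + 1 = m l) (h : ℝ) (j : Fin d → ℤ) :
    blurred (wavyBlur f m h) (testSignal a b) j - blurred (plainBlur f h) (testSignal a b) j
      = imageDiff f a m h j := by
  have : b = fun l => a l + m l - 1 := by
    ext l
    have := hab l
    omega
  rw [this, blurred_testSignal, blurred_testSignal, imageDiff, Finset.sum_sub_distrib]

/-- The norming constant `c_{1,1}` does not degenerate for large `n`. -/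
lemma eventually_c₁_ne_zero {p : ℝ} (hp : 0 < p) (hd : 1 ≤ d) (hfp : FtDecay f p) {δ : ℕ → ℝ}
    (hδ0 : ∀ n, 0 < δ n) (hδ : Tendsto δ atTop (𝓝 0)) {e : ℕ → Fin d → ℝ} {c : Fin d → ℝ}
    (hc : ∀ l, 0 < c l) (he : ∀ l, Tendsto (fun n => e n l) atTop (𝓝 (c l))) :
    ∀ᶠ n in atTop, c₁ f (δ n) (edgeFrequency (e n)) 1 ≠ 0 := by
  obtain ⟨C, hC0, hC⟩ := hfp.exists_bound
  set i : Fin d := ⟨0, by omega⟩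
  have hfreq : Tendsto (fun n => (δ n)⁻¹ * (2 * Real.pi / e n i)) atTop atTop := by
    have h1 : Tendsto (fun n => (δ n)⁻¹) atTop atTop :=
      tendsto_inv_nhdsGT_zero.comp (tendsto_nhdsWithin_iff.2 ⟨hδ, Eventually.of_forall hδ0⟩)
    have h2 : Tendsto (fun n => 2 * Real.pi / e n i) atTop (𝓝 (2 * Real.pi / c i)) :=
      tendsto_const_nhds.div (he i) (hc i).ne'
    exact h1.atTop_mul_pos (by have := hc i; positivity) h2
  have hnorm : Tendsto (fun n => 1 + ‖(δ n)⁻¹ • edgeFrequency (e n)‖) atTop atTop := by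
    refine tendsto_atTop_add_const_left _ _ (tendsto_atTop_mono (fun n => ?_) hfreq)
    have h1 := PiLp.norm_apply_le ((δ n)⁻¹ • edgeFrequency (e n)) i
    exact (le_abs_self _).trans h1
  have hlim : Tendsto (fun n => C * (1 + ‖(δ n)⁻¹ • edgeFrequency (e n)‖) ^ (-p)) atTop (𝓝 0) := by
    have := ((tendsto_rpow_neg_atTop hp).comp hnorm).const_mul C
    rwa [mul_zero] at this
  filter_upwards [hlim.eventually (gt_mem_nhds one_pos)] with n hn
  have h1 := (Complex.abs_re_le_norm (ft f ((δ n)⁻¹ • edgeFrequency (e n)))).trans (hC _)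
  have h2 := (abs_lt.1 (h1.trans_lt hn)).1
  rw [c₁, one_mul]
  exact inv_ne_zero (by linarith)

end Link

/-! ### Mean summed squared error at two blurs -/

section Risk

lemma ofReal_half_sq_le (z : ℂ) (x y : ℝ) :
    ENNReal.ofReal ((y - x) ^ 2 / 2) ≤ ‖z - (x : ℂ)‖ₑ ^ 2 + ‖z - (y : ℂ)‖ₑ ^ 2 := by
  rw [← ofReal_norm, ← ofReal_norm, ← ENNReal.ofReal_pow (norm_nonneg _),
    ← ENNReal.ofReal_pow (norm_nonneg _), ← ENNReal.ofReal_add (by positivity) (by positivity)]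
  refine ENNReal.ofReal_le_ofReal ?_
  have h1 : ‖((y - x : ℝ) : ℂ)‖ ≤ ‖z - (x : ℂ)‖ + ‖z - (y : ℂ)‖ := by
    have : ((y - x : ℝ) : ℂ) = (z - x) - (z - y) := by push_cast; ring
    rw [this]
    exact norm_sub_le _ _
  rw [Complex.norm_real, Real.norm_eq_abs] at h1
  have h2 : (y - x) ^ 2 ≤ (‖z - (x : ℂ)‖ + ‖z - (y : ℂ)‖) ^ 2 := by
    rw [← sq_abs]
    gcongr
  nlinarith [sq_nonneg (‖z - (x : ℂ)‖ - ‖z - (y : ℂ)‖)]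

/-- If two blurs have images that are close relative to the noise, then no estimator can do well at
both of them. -/
theorem le_MSSE_add_MSSE {Ω : Type*} [MeasurableSpace Ω] {P : Measure Ω} [IsProbabilityMeasure P]
    {N : (Fin d → ℤ) → Ω → ℝ} {σ : ℝ} (hσ : 0 < σ) (hN : ∀ j, Measurable (N j))
    (hind : iIndepFun N P) (hlaw : ∀ j, P.map (N j) = gaussianReal 0 (σ ^ 2).toNNReal)
    {ψ φ₀ φ₁ : (Fin d → ℤ) → ℝ} {J : Finset (Fin d → ℤ)}
    (hJ : ∀ j ∉ J, blurred φ₁ ψ j - blurred φ₀ ψ j = 0) {M : ℝ}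
    (hM : ∑ j ∈ J, (blurred φ₁ ψ j - blurred φ₀ ψ j) ^ 2 ≤ M * σ ^ 2) {J' : Finset (Fin d → ℤ)}
    {s : ℝ} (hs : s ≤ ∑ j ∈ J', (φ₁ j - φ₀ j) ^ 2)
    {est : ((Fin d → ℤ) → ℝ) → (Fin d → ℤ) → ℂ} (hest : Measurable est) :
    ENNReal.ofReal (Real.exp (-M / 2)) * ENNReal.ofReal (s / 2) / 2
      ≤ MSSE P N ψ φ₀ est + MSSE P N ψ φ₁ est := by
  have hσ2 : (0 : ℝ) < σ ^ 2 := by positivity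
  have hmeas : ∀ φ : (Fin d → ℤ) → ℝ, Measurable fun y : (Fin d → ℤ) → ℝ =>
      ∑' j, ‖est (fun k => blurred φ₀ ψ k + y k) j - (φ j : ℂ)‖ₑ ^ 2 := by
    intro φ
    refine Measurable.tsum fun j => ?_
    have h1 : Measurable fun y : (Fin d → ℤ) → ℝ => fun k => blurred φ₀ ψ k + y k :=
      measurable_pi_iff.2 fun k => (measurable_pi_apply k).const_add _
    have h2 : Measurable fun y : (Fin d → ℤ) → ℝ => est (fun k => blurred φ₀ ψ k + y k) j :=
      (measurable_pi_apply j).comp (hest.comp h1)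
    exact ((h2.sub_const _).enorm).pow_const 2
  have key := le_lintegral_add_lintegral_shift hN hind hlaw
    (by simpa using hσ.ne') J (fun j => blurred φ₁ ψ j - blurred φ₀ ψ j) hJ (M := M)
    (by rwa [Real.coe_toNNReal _ hσ2.le]) (hmeas φ₀) (hmeas φ₁) (κ := ENNReal.ofReal (s / 2)) ?_
  · refine key.trans (le_of_eq ?_)
    rw [MSSE, MSSE]
    congr 2
    ext ω
    have : (fun k => blurred φ₀ ψ k + (N k ω + (blurred φ₁ ψ k - blurred φ₀ ψ k)))
        = fun k => blurred φ₁ ψ k + N k ω := by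
      ext k; ring
    simp only [this]
  · intro y
    rw [← ENNReal.tsum_add]
    calc ENNReal.ofReal (s / 2) ≤ ENNReal.ofReal (∑ j ∈ J', (φ₁ j - φ₀ j) ^ 2 / 2) := by
          rw [← Finset.sum_div]
          exact ENNReal.ofReal_le_ofReal (by linarith)
      _ = ∑ j ∈ J', ENNReal.ofReal ((φ₁ j - φ₀ j) ^ 2 / 2) :=
          ENNReal.ofReal_sum_of_nonneg fun j _ => by positivity
      _ ≤ ∑ j ∈ J', (‖est (fun k => blurred φ₀ ψ k + y k) j - (φ₀ j : ℂ)‖ₑ ^ 2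
            + ‖est (fun k => blurred φ₀ ψ k + y k) j - (φ₁ j : ℂ)‖ₑ ^ 2) :=
          Finset.sum_le_sum fun j _ => ofReal_half_sq_le _ _ _
      _ ≤ _ := ENNReal.sum_le_tsum J'

end Risk

/-! ### Rates -/

section Rates

lemma tendsto_of_pow_le_rpow {δ : ℕ → ℝ} (hδ : ∀ n, 0 < δ n) {k : ℕ} {C c : ℝ}
    (hc : 0 < c) (h : ∀ n : ℕ, 1 ≤ n → δ n ^ k ≤ C * (n : ℝ) ^ (-c)) :
    Tendsto δ atTop (𝓝 0) := by
  have h1 : Tendsto (fun n : ℕ => C * (n : ℝ) ^ (-c)) atTop (𝓝 0) := by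
    have := ((tendsto_rpow_neg_atTop hc).comp tendsto_natCast_atTop_atTop).const_mul C
    rwa [mul_zero] at this
  refine tendsto_order.2 ⟨fun x hx => Eventually.of_forall fun n => hx.trans (hδ n),
    fun x hx => ?_⟩
  filter_upwards [h1.eventually (gt_mem_nhds (pow_pos hx k)), eventually_ge_atTop 1] with n hn hn1
  exact lt_of_pow_lt_pow_left₀ k hx.le ((h n hn1).trans_lt hn)

/-- In the regime `δ ≍ (σ² / n^d)^{1/(3d)}` the quantities `n^d δ^{3d}` and `σ²` are comparable. -/
lemma eventually_rate_bounds {d : ℕ} (hd : 1 ≤ d) {δ σ : ℕ → ℝ} (hδ : ∀ n, 0 < δ n)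
    (hσ : ∀ n, 0 < σ n)
    (h : δ =Θ[atTop] fun n : ℕ => (σ n ^ 2 / (n : ℝ) ^ d) ^ (1 / (3 * (d : ℝ)))) :
    ∃ A > 0, ∃ B > 0, ∀ᶠ n : ℕ in atTop,
      (n : ℝ) ^ d * δ n ^ (3 * d) ≤ A * σ n ^ 2 ∧ B * σ n ^ 2 ≤ (n : ℝ) ^ d * δ n ^ (3 * d) := by
  obtain ⟨K, hK, h1⟩ := h.1.exists_pos
  obtain ⟨K', hK', h2⟩ := h.2.exists_pos
  refine ⟨K ^ (3 * d), by positivity, (K' ^ (3 * d))⁻¹, by positivity, ?_⟩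
  filter_upwards [h1.bound, h2.bound, eventually_ge_atTop 1] with n hn1 hn2 hn
  have hn0 : (0 : ℝ) < (n : ℝ) ^ d := by
    have : (0 : ℝ) < n := by exact_mod_cast hn
    positivity
  have hσn := hσ n
  set y := σ n ^ 2 / (n : ℝ) ^ d with hy
  have hy0 : 0 ≤ y := by positivity
  have hyp : (y ^ (1 / (3 * (d : ℝ)))) ^ (3 * d) = y := by
    rw [← Real.rpow_natCast, ← Real.rpow_mul hy0]
    have : (d : ℝ) ≠ 0 := by exact_mod_cast (by omega : d ≠ 0)
    push_cast
    rw [one_div, inv_mul_cancel₀ (by positivity), Real.rpow_one]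
  rw [Real.norm_eq_abs, Real.norm_eq_abs, abs_of_pos (hδ n), abs_of_nonneg (by positivity)]
    at hn1 hn2
  have hδn := (hδ n).le
  have h3 : δ n ^ (3 * d) ≤ K ^ (3 * d) * y := by
    rw [← hyp, ← mul_pow]
    gcongr
  have h4 : y ≤ K' ^ (3 * d) * δ n ^ (3 * d) := by
    calc y = (y ^ (1 / (3 * (d : ℝ)))) ^ (3 * d) := hyp.symm
      _ ≤ (K' * δ n) ^ (3 * d) := by gcongr
      _ = _ := mul_pow _ _ _
  constructor
  · calc (n : ℝ) ^ d * δ n ^ (3 * d) ≤ (n : ℝ) ^ d * (K ^ (3 * d) * y) := by gcongr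
      _ = _ := by rw [hy]; field_simp
  · rw [inv_mul_le_iff₀ (by positivity)]
    calc σ n ^ 2 = (n : ℝ) ^ d * y := by rw [hy]; field_simp
      _ ≤ (n : ℝ) ^ d * (K' ^ (3 * d) * δ n ^ (3 * d)) := by gcongr
      _ = _ := by ring

end Rates

/-! ### The lower bound -/

section LowerBound

variable {f : EuclideanSpace ℝ (Fin d) → ℝ}

/-- For large `n` the two blurs of the theorem sum to one, their images of the test signal differ
by at most the order of the noise, and the blurs themselves differ by the order `(δ/n)^d`. -/
lemma eventually_blur_bounds {p : ℝ} (hd : 1 ≤ d) (hf : IsProfile f) (hfp : FtDecay f p)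
    (hp : 3 / 2 * (d : ℝ) < p) {δ σ : ℕ → ℝ} (hδ0 : ∀ n, 0 < δ n) (hδ : Tendsto δ atTop (𝓝 0))
    {A : ℝ}
    (hrate : ∀ᶠ n : ℕ in atTop, (n : ℝ) ^ d * δ n ^ (3 * d) ≤ A * σ n ^ 2)
    {a b : ℕ → Fin d → ℤ} {c : Fin d → ℝ} (hc : ∀ l, 0 < c l)
    (hedge : ∀ l, Tendsto (fun n => edge (a n) (b n) n l) atTop (𝓝 (c l))) :
    ∃ M : ℝ, ∃ s > 0, ∀ᶠ n in atTop, ∃ φ₀ φ₁ : (Fin d → ℤ) → ℝ,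
      blur f (δ n) (edgeFrequency (edge (a n) (b n) n)) n 0 = φ₀ ∧
      blur f (δ n) (edgeFrequency (edge (a n) (b n) n)) n 1 = φ₁ ∧
      ∑' j, φ₀ j = 1 ∧ ∑' j, φ₁ j = 1 ∧
      (∃ J : Finset (Fin d → ℤ),
        (∀ j ∉ J, blurred φ₁ (testSignal (a n) (b n)) j
          - blurred φ₀ (testSignal (a n) (b n)) j = 0) ∧
        ∑ j ∈ J, (blurred φ₁ (testSignal (a n) (b n)) j
          - blurred φ₀ (testSignal (a n) (b n)) j) ^ 2 ≤ M * σ n ^ 2) ∧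
      ∃ J : Finset (Fin d → ℤ), s * (δ n / n) ^ d ≤ ∑ j ∈ J, (φ₁ j - φ₀ j) ^ 2 := by
  obtain ⟨κ, hκ, C, hC, s, hs, hmain⟩ := exists_blur_bounds hd hf hfp hp
  have hp0 : 0 < p := by
    have : (1 : ℝ) ≤ d := by exact_mod_cast hd
    linarith
  set G := ∏ l, (2 * c l) with hG
  have hG0 : 0 < G := Finset.prod_pos fun l _ => by have := hc l; positivity
  refine ⟨C * G ^ 4 * A, s, hs, ?_⟩
  have hlow : ∀ᶠ n in atTop, ∀ l, c l / 2 < edge (a n) (b n) n l :=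
    eventually_all.2 fun l => (hedge l).eventually (lt_mem_nhds (half_lt_self (hc l)))
  have hup : ∀ᶠ n in atTop, ∀ l, edge (a n) (b n) n l < 2 * c l :=
    eventually_all.2 fun l => (hedge l).eventually (gt_mem_nhds (by have := hc l; linarith))
  have hbig : ∀ᶠ n : ℕ in atTop, ∀ l, 12 ≤ c l / 2 * n := by
    refine eventually_all.2 fun l => ?_
    have : Tendsto (fun n : ℕ => c l / 2 * (n : ℝ)) atTop atTop :=
      tendsto_natCast_atTop_atTop.const_mul_atTop (half_pos (hc l))
    exact this.eventually_ge_atTop 12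
  have hsmall : ∀ᶠ n in atTop, ∀ l, 2 * c l * δ n ≤ κ := by
    refine eventually_all.2 fun l => ?_
    have : Tendsto (fun n => 2 * c l * δ n) atTop (𝓝 0) := by
      simpa using hδ.const_mul (2 * c l)
    exact (this.eventually (gt_mem_nhds hκ)).mono fun n hn => hn.le
  filter_upwards [hlow, hup, hbig, hsmall, hrate, eventually_ge_atTop 1,
    eventually_c₁_ne_zero hp0 hd hfp hδ0 hδ hc hedge] with n hlown hupn hbign hsmalln hraten hn hc₁
  have hn0 : (0 : ℝ) < n := by exact_mod_cast hn
  have hδn := hδ0 n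
  set m : Fin d → ℕ := fun l => (b n l - a n l + 1).toNat with hm
  have hedgepos : ∀ l, 12 ≤ ((b n l - a n l + 1 : ℤ) : ℝ) := by
    intro l
    have h1 := hlown l
    rw [edge, lt_div_iff₀ hn0] at h1
    exact (hbign l).trans h1.le
  have hedgepos' : ∀ l, 12 ≤ b n l - a n l + 1 := fun l => by exact_mod_cast hedgepos l
  have hab : ∀ l, b n l - a n l + 1 = m l := fun l => by
    have := hedgepos' l
    simp only [hm]
    omega
  have hm12 : ∀ l, 12 ≤ m l := fun l => by
    have := hedgepos' l
    simp only [hm]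
    omega
  have hmn : ∀ l, (m l : ℝ) = edge (a n) (b n) n l * n := by
    intro l
    rw [edge, hab, div_mul_cancel₀ _ hn0.ne', Int.cast_natCast]
  have hmup : ∀ l, (m l : ℝ) ≤ 2 * c l * n := fun l => by
    rw [hmn]
    have := hupn l
    gcongr
  have hmκ : ∀ l, m l * (δ n / n) ≤ κ := by
    intro l
    calc m l * (δ n / n) ≤ 2 * c l * n * (δ n / n) := by
          have := hmup l
          gcongr
      _ = 2 * c l * δ n := by field_simp
      _ ≤ κ := hsmalln l
  obtain ⟨hU, hS, ⟨J, hJ0, hJ⟩, J', hJ'⟩ := hmain (a n) m (δ n / n) (by positivity) hm12 hmκ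
  refine ⟨plainBlur f (δ n / n), wavyBlur f m (δ n / n), blur_zero_eq hδn (by omega) hab,
    blur_one_eq hδn (by omega) hab hc₁, tsum_plainBlur hU, tsum_wavyBlur hS, ⟨J, ?_, ?_⟩, J', hJ'⟩
  · intro j hj
    rw [blurred_sub_blurred_eq_imageDiff f hab, hJ0 j hj]
  · simp_rw [blurred_sub_blurred_eq_imageDiff f hab]
    refine hJ.trans ?_
    have hprod : ∏ l, (m l : ℝ) ≤ G * n ^ d := by
      calc ∏ l, (m l : ℝ) ≤ ∏ l, (2 * c l * n) :=
            Finset.prod_le_prod (fun l _ => by positivity) fun l _ => hmup l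
        _ = G * n ^ d := by
            rw [Finset.prod_mul_distrib, Finset.prod_const, Finset.card_univ, Fintype.card_fin]
    calc C * (∏ l, (m l : ℝ)) ^ 4 * (δ n / n) ^ (3 * d)
        ≤ C * (G * n ^ d) ^ 4 * (δ n / n) ^ (3 * d) := by gcongr
      _ = C * G ^ 4 * ((n : ℝ) ^ d * δ n ^ (3 * d)) := by
          rw [div_pow, show (n : ℝ) ^ (3 * d) = ((n : ℝ) ^ d) ^ 3 by rw [← pow_mul, mul_comm]]
          field_simp
      _ ≤ C * G ^ 4 * (A * σ n ^ 2) := by gcongr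
      _ = C * G ^ 4 * A * σ n ^ 2 := by ring

/-- The lower bound on the normalized risk: `x = n^d`, `D = δ^d` and `v = σ²`. -/
lemma sqrt_mul_rate_ge {x D v B : ℝ} (hx : 0 < x) (hD : 0 < D) (hv : 0 < v)
    (h : B * v ≤ x * D ^ 3) : Real.sqrt B ≤ (x / (D⁻¹ * v)) ^ (1 / 2 : ℝ) * D := by
  rw [← Real.sqrt_eq_rpow]
  nth_rewrite 2 [← Real.sqrt_sq hD.le]
  rw [← Real.sqrt_mul (by positivity)]
  refine Real.sqrt_le_sqrt ?_
  have h1 : x / (D⁻¹ * v) * D ^ 2 = x * D ^ 3 / v := by field_simp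
  rw [h1, le_div_iff₀ hv]
  exact h

end LowerBound

end BlurEstimation

theorem theorem3p2 (d : ℕ) (hd : 1 ≤ d) :
    -- the frequency vector is a function of the edge lengths of the test signal alone
    ∃ Ξ : (Fin d → ℝ) → EuclideanSpace ℝ (Fin d),
      ∀ (f : EuclideanSpace ℝ (Fin d) → ℝ) (p : ℝ),
        BlurEstimation.IsProfile f → BlurEstimation.FtDecay f p →
      ∀ (C₁ C₂ C₃ C₄ : ℝ), 0 < C₁ → 0 < C₂ → 0 < C₃ → 0 < C₄ →
        (d : ℝ) * (1 - p⁻¹) ≤ C₄ → C₄ ≤ C₂ →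
        3 / 2 * (d : ℝ) < p → 3 / 4 * C₂ + 1 ≤ p →
      ∀ (lam σ : ℕ → ℝ), (∀ n, 0 < lam n) → (∀ n, 0 < σ n) →
        ((fun n => (lam n)⁻¹) =Θ[atTop]
          fun n : ℕ => (σ n ^ 2 / (n : ℝ) ^ d) ^ (1 / (3 * (d : ℝ)))) →
        (∀ n : ℕ, 1 ≤ n →
          C₁ * (n : ℝ) ^ (-C₂) ≤ (lam n)⁻¹ ^ (2 * d) ∧
            (lam n)⁻¹ ^ (2 * d) ≤ C₃ * (n : ℝ) ^ (-C₄)) →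
      -- the corners of the prism, with `m_ℓ / n` converging to a positive limit
      ∀ (a b : ℕ → Fin d → ℤ) (c : Fin d → ℝ), (∀ l, 0 < c l) →
        (∀ l, Tendsto (fun n => BlurEstimation.edge (a n) (b n) n l) atTop (𝓝 (c l))) →
      -- at stage `n` the noise is i.i.d. `N(0, σ_n²)`
      ∀ (Ω : Type*) [MeasurableSpace Ω] (P : Measure Ω) [IsProbabilityMeasure P]
        (N : ℕ → (Fin d → ℤ) → Ω → ℝ),
        (∀ n j, Measurable (N n j)) →
        (∀ n, iIndepFun (N n) P) →
        (∀ n j, P.map (N n j) = gaussianReal 0 (σ n ^ 2).toNNReal) →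
      let φ : ℝ → ℕ → (Fin d → ℤ) → ℝ := fun θ n =>
        BlurEstimation.blur f (lam n)⁻¹ (Ξ (BlurEstimation.edge (a n) (b n) n)) n θ
      -- for all large `n` the standardization is possible
      (∀ θ ∈ ({0, 1} : Set ℝ), ∀ᶠ n in atTop, ∑' j, φ θ n j = 1) ∧
      -- the lower bound, for every sequence of estimators
      ∀ est : ℕ → ((Fin d → ℤ) → ℝ) → (Fin d → ℤ) → ℂ, (∀ n, Measurable (est n)) →
        0 < liminf (fun n : ℕ =>
          ENNReal.ofReal (((n : ℝ) ^ d / (lam n ^ d * σ n ^ 2)) ^ (1 / 2 : ℝ)) *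
            ⨆ θ ∈ ({0, 1} : Set ℝ), (n : ℝ≥0∞) ^ d *
              BlurEstimation.MSSE P (N n) (BlurEstimation.testSignal (a n) (b n)) (φ θ n)
                (est n)) atTop := by
  refine ⟨BlurEstimation.edgeFrequency, fun f p hf hfp C₁ C₂ C₃ C₄ _ _ _ hC₄ _ _ hp _ lam σ hlam hσ
    hrate hpoly a b c hc hedge Ω _ P _ N hN hind hlaw => ?_⟩
  intro φ
  have hδ0 : ∀ n, 0 < (lam n)⁻¹ := fun n => inv_pos.2 (hlam n)
  have hδ : Tendsto (fun n => (lam n)⁻¹) atTop (𝓝 0) :=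
    BlurEstimation.tendsto_of_pow_le_rpow hδ0 hC₄ fun n hn => (hpoly n hn).2
  obtain ⟨A, -, B, hB, hAB⟩ := BlurEstimation.eventually_rate_bounds hd hδ0 hσ hrate
  obtain ⟨M, s, hs, hmain⟩ := BlurEstimation.eventually_blur_bounds hd hf hfp hp hδ0 hδ
    (hAB.mono fun n hn => hn.1) hc hedge
  constructor
  · intro θ hθ
    filter_upwards [hmain] with n hn
    obtain ⟨φ₀, φ₁, h₀, h₁, hs₀, hs₁, -⟩ := hn
    rcases hθ with rfl | hθ
    · simpa only [φ, h₀] using hs₀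
    · rw [Set.mem_singleton_iff] at hθ
      subst hθ
      simpa only [φ, h₁] using hs₁
  · intro est hest
    set q : ℝ := Real.sqrt B * (Real.exp (-M / 2) * (s / 8)) with hq
    have hq0 : 0 < q := by
      have := Real.sqrt_pos.2 hB
      positivity
    refine lt_of_lt_of_le (ENNReal.ofReal_pos.2 hq0) (le_liminf_of_le (by isBoundedDefault) ?_)
    filter_upwards [hmain, hAB, eventually_ge_atTop 1] with n hn hABn hn1
    obtain ⟨φ₀, φ₁, h₀, h₁, -, -, ⟨J, hJ0, hJ⟩, J', hJ'⟩ := hn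
    have hrisk := BlurEstimation.le_MSSE_add_MSSE (hσ n) (hN n) (hind n) (hlaw n) hJ0 hJ hJ'
      (hest n)
    rw [iSup_pair]
    simp only [φ, h₀, h₁]
    set R₀ := BlurEstimation.MSSE P (N n) (BlurEstimation.testSignal (a n) (b n)) φ₀ (est n)
    set R₁ := BlurEstimation.MSSE P (N n) (BlurEstimation.testSignal (a n) (b n)) φ₁ (est n)
    set D := (lam n)⁻¹ ^ d with hD
    have hn0 : (0 : ℝ) < n := by exact_mod_cast hn1
    have hD0 : 0 < D := pow_pos (hδ0 n) d
    have hσn := hσ n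
    have hlamD : lam n ^ d = D⁻¹ := by rw [hD, inv_pow, inv_inv]
    have hrate' : Real.sqrt B ≤
        ((n : ℝ) ^ d / (lam n ^ d * σ n ^ 2)) ^ (1 / 2 : ℝ) * D := by
      rw [hlamD]
      refine BlurEstimation.sqrt_mul_rate_ge (by positivity) hD0 (by positivity) ?_
      rw [hD, ← pow_mul, mul_comm d 3]
      exact hABn.2
    set W := ((n : ℝ) ^ d / (lam n ^ d * σ n ^ 2)) ^ (1 / 2 : ℝ) with hW
    have hlamn := hlam n
    have hW0 : 0 ≤ W := by positivity
    set T : ℝ := s * ((lam n)⁻¹ / n) ^ d with hT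
    have hT0 : 0 ≤ T := by
      have := hδ0 n
      positivity
    -- the larger of the two risks is at least half their sum
    have hmax : ENNReal.ofReal (Real.exp (-M / 2) * (T / 8)) ≤ R₀ ⊔ R₁ := by
      have h1 : ENNReal.ofReal (Real.exp (-M / 2)) * ENNReal.ofReal (T / 2) / 2
          = 2 * ENNReal.ofReal (Real.exp (-M / 2) * (T / 8)) := by
        rw [← ENNReal.ofReal_mul (Real.exp_pos _).le, ← ENNReal.ofReal_ofNat 2,
          ← ENNReal.ofReal_div_of_pos two_pos, ← ENNReal.ofReal_mul zero_le_two]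
        congr 1
        ring
      rw [h1] at hrisk
      have h2 : R₀ + R₁ ≤ 2 * (R₀ ⊔ R₁) := by
        rw [two_mul]
        exact add_le_add le_sup_left le_sup_right
      exact (ENNReal.mul_le_mul_iff_right two_ne_zero ENNReal.ofNat_ne_top).1 (hrisk.trans h2)
    calc ENNReal.ofReal q
        ≤ ENNReal.ofReal (W * ((n : ℝ) ^ d * (Real.exp (-M / 2) * (T / 8)))) := by
          refine ENNReal.ofReal_le_ofReal ?_
          have h1 : W * ((n : ℝ) ^ d * (Real.exp (-M / 2) * (T / 8)))
              = W * D * (Real.exp (-M / 2) * (s / 8)) := by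
            rw [hT, div_pow, ← hD]
            field_simp
          rw [h1, hq]
          gcongr
      _ = ENNReal.ofReal W * ((n : ℝ≥0∞) ^ d *
            ENNReal.ofReal (Real.exp (-M / 2) * (T / 8))) := by
          rw [ENNReal.ofReal_mul hW0, ENNReal.ofReal_mul (by positivity),
            ENNReal.ofReal_pow hn0.le, ENNReal.ofReal_natCast]
      _ ≤ ENNReal.ofReal W * ((n : ℝ≥0∞) ^ d * (R₀ ⊔ R₁)) := by gcongr
      _ ≤ _ := by
          gcongr
          rcases le_total R₀ R₁ with h | h
          · rw [sup_eq_right.2 h]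
            exact le_sup_right
          · rw [sup_eq_left.2 h]
            exact le_sup_left
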